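/- Theorem (torus condition). Let $f:\mathbb C\to\mathbb CP^2$ be a conformally parametrized minimal Lagrangian immersion (Fubini–Study metric of holomorphic sectional curvature $4$) which is translationally equivariant: there is a one-parameter subgroup $R$ of $SU(3)$ with $f(t+z)=R(t)f(z)$ for all $t\in\mathbb R$, $z\in\mathbb C$. Write the induced metric as $2e^{u}\,dz\,d\bar z$, where by equivariance $u=u(y)$, $y=\operatorname{Im} z$, and let $\psi\,dz^3$, $\psi=F_{zz}\cdot\overline{F_{\bar z}}$ for a horizontal lift $F:\mathbb C\to S^5$ of $f$, be its Hopf differential; $\psi$ is constant. Assume $\psi\neq0$ and that the origin is chosen so that $u'(0)=0$. For $|\lambda|=1$ let $f(\cdot,\lambda):\mathbb C\to\mathbb CP^2$ be the member of the associated family of $f$, that is, the minimal Lagrangian immersion, unique up to isometries, with the same metric and with Hopf differential $-i\lambda^{-3}\psi\,dz^3$. Put $a_1=e^{u(0)}$, $\beta=2a_1+|\psi|^2/a_1^2$, $c=\beta/2-a_1$, $$a_2=\tfrac12\big(c+\sqrt{c^2+4a_1c}\big),\quad a_3=\tfrac12\big(-c+\sqrt{c^2+4a_1c}\big),\quad k^2=\frac{a_1-a_2}{a_1+a_3},\quad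 r=\sqrt{2(a_1+a_3)},$$ $$T=\frac1r\int_0^{\pi/2}\frac{d\alpha}{\sqrt{1-k^2\sin^2\alpha}}$$ (if $u$ is not constant, $2T$ is its smallest period), and $$D(\lambda)=\begin{pmatrix}0&-i\lambda\bar\psi e^{-u(0)}&i\lambda^{-1}e^{u(0)/2}\\-i\lambda^{-1}\psi e^{-u(0)}&0&i\lambda e^{u(0)/2}\\ i\lambda e^{u(0)/2}&i\lambda^{-1}e^{u(0)/2}&0\end{pmatrix},\qquad \beta_2(2T,\lambda)=\int_0^{2T}\frac{2e^{u}}{\lambda^3\bar\psi-\lambda^{-3}\psi-e^{u}u'}\,dy,$$ the integral being convergent when $\lambda^{-3}\psi\notin\mathbb R$. Fix $\lambda_0$ with $|\lambda_0|=1$ and let $id_1,id_2,id_3$ be the (purely imaginary) eigenvalues of $D(\lambda_0)$, with multiplicity and in any order. Assume that $f$ is not flat (i.e. $u$ is not constant), or that $D(\lambda_0)$ has a multiple eigenvalue. Then $f(\cdot,\lambda_0)$ descends to a torus, i.e. it has two periods that are linearly independent over $\mathbb R$, if and only if both of the following hold: 1. $d_1$ and $d_2$ have a rational quotient: $d_2=0$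 or $d_1/d_2\in\mathbb Q$; 2. $d_1=d_2$, or $\lambda_0^{-3}\psi$ is real, or $\frac1{2\pi}\operatorname{Im}\beta_2(2T,\lambda_0)\,\big(d_1d_2+\tfrac{2\beta}{3}\big)$ is rational. -/

import Mathlib

open scoped ContDiff ComplexConjugate

namespace EquivMinLag

noncomputable section

/-- The Hermitian space `ℂ³`. -/
abbrev C3 : Type := EuclideanSpace ℂ (Fin 3)

/-- The complex projective plane. -/
abbrev CP2 : Type := Projectivization ℂ C3

/-- Partial derivatives with respect to the real coordinates of `z = x + i y`. -/
def dx (F : ℂ → C3) (z : ℂ) : C3 := fderiv ℝ F z 1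

def dy (F : ℂ → C3) (z : ℂ) : C3 := fderiv ℝ F z Complex.I

/-- The Wirtinger derivatives `F_z = (F_x - i F_y) / 2` and `F_{z̄} = (F_x + i F_y) / 2`. -/
def dz (F : ℂ → C3) (z : ℂ) : C3 := (1 / 2 : ℂ) • (dx F z - Complex.I • dy F z)

def dzbar (F : ℂ → C3) (z : ℂ) : C3 := (1 / 2 : ℂ) • (dx F z + Complex.I • dy F z)

/-- `F : ℂ → S⁵ ⊂ ℂ³` is a smooth lift of `f : ℂ → ℂP²` which is horizontal for the Hopf fibration
`S⁵ → ℂP²`. (Mathlib's `inner ℂ W Z` is `∑ Z_k conj W_k`, written `Z · W̄`.) -/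
structure IsHorizontalLift (f : ℂ → CP2) (F : ℂ → C3) : Prop where
  smooth : ContDiff ℝ ∞ F
  norm_eq_one : ∀ z, ‖F z‖ = 1
  lifts : ∀ z, (f z).submodule = Submodule.span ℂ {F z}
  horizontal_x : ∀ z, inner ℂ (F z) (dx F z) = 0
  horizontal_y : ∀ z, inner ℂ (F z) (dy F z) = 0

/-- `f : ℂ → ℂP²` is a conformally parametrized minimal Lagrangian immersion, with horizontal
lift `F`. As `ℂ` is simply connected, every Lagrangian immersion `ℂ → ℂP²` has such a
lift, unique up to a constant unit factor; the Hopf fibration being a Riemannian submersion onto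
`ℂP²` with the Fubini-Study metric of holomorphic sectional curvature `4`,
the metric, the Kähler form and the second fundamental form of `f` are read off from `F`. -/
structure IsMinimalLagrangian (f : ℂ → CP2) (F : ℂ → C3) : Prop where
  lift : IsHorizontalLift f F
  immersion : ∀ z, dx F z ≠ 0
  conformal_norm : ∀ z, ‖dx F z‖ = ‖dy F z‖
  conformal_angle : ∀ z, (inner ℂ (dx F z) (dy F z)).re = 0
  /-- The pullback of the Kähler form vanishes. -/
  lagrangian : ∀ z, (inner ℂ (dx F z) (dy F z)).im = 0
  /-- The mean curvature vector vanishes: up to vertical terms (multiples of `F`),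
  `F_xx + F_yy` is tangent to the surface. -/
  minimal : ∀ z, ∃ (a b : ℝ) (c : ℂ),
    dx (dx F) z + dy (dy F) z = (a : ℂ) • dx F z + (b : ℂ) • dy F z + c • F z

/-- The function `u` with induced metric `2 e^u dz dz̄`, that is `e^u = F_z · conj F_z`. -/
def logFactor (F : ℂ → C3) (z : ℂ) : ℝ := Real.log (‖dz F z‖ ^ 2)

/-- The coefficient `F_zz · conj F_z̄` of the Hopf differential. -/
def hopf (F : ℂ → C3) (z : ℂ) : ℂ := inner ℂ (dzbar F z) (dz (dz F) z)

/-- Equivariance under all real translations of the domain, relative to a one-parameter subgroup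
`R` of `SU(3)` acting on lines in `ℂ³`. -/
def IsTranslationallyEquivariant (f : ℂ → CP2) : Prop :=
  ∃ R : ℝ → Matrix.specialUnitaryGroup (Fin 3) ℂ, Continuous R ∧
    (∀ s t, R (s + t) = R s * R t) ∧
    ∀ (t : ℝ) (z : ℂ), (f (t + z)).submodule =
      (f z).submodule.map (Matrix.toEuclideanLin (R t : Matrix (Fin 3) (Fin 3) ℂ))

/-- The surfaces with horizontal lifts `F` and `G` have the same metric, and the Hopf differential
of the second one is `-i λ⁻³` times that of the first: for `|λ| = 1`, the second surface is the
member at the parameter `λ` of the associated family of the first one. -/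
def IsAssociate (lam : ℂ) (F G : ℂ → C3) : Prop :=
  ∀ z, logFactor G z = logFactor F z ∧ hopf G z = -Complex.I * lam⁻¹ ^ 3 * hopf F z

/-- Two periods that are linearly independent over `ℝ`. -/
def DescendsToTorus (f : ℂ → CP2) : Prop :=
  ∃ ω₁ ω₂ : ℂ, LinearIndependent ℝ ![ω₁, ω₂] ∧
    (∀ z, f (z + ω₁) = f z) ∧ ∀ z, f (z + ω₂) = f z

/-- The matrix `D(λ)` of the constant potential `D(λ) dz`, where `u0 = u(0)`. -/
def potential (psi : ℂ) (u0 : ℝ) (lam : ℂ) : Matrix (Fin 3) (Fin 3) ℂ :=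
  !![0, -Complex.I * lam * conj psi * (Real.exp (-u0) : ℂ),
      Complex.I * lam⁻¹ * (Real.exp (u0 / 2) : ℂ);
    -Complex.I * lam⁻¹ * psi * (Real.exp (-u0) : ℂ), 0,
      Complex.I * lam * (Real.exp (u0 / 2) : ℂ);
    Complex.I * lam * (Real.exp (u0 / 2) : ℂ),
      Complex.I * lam⁻¹ * (Real.exp (u0 / 2) : ℂ), 0]

/-- `β = 2 a₁ + |ψ|² / a₁²`, where `a₁ = e^{u(0)}`. -/
def betaConst (psi : ℂ) (a1 : ℝ) : ℝ := 2 * a1 + ‖psi‖ ^ 2 / a1 ^ 2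

/-- The numbers `a₂` and `a₃` with
`w³ - (β/2) w² + |ψ|²/2 = (w - a₁) (w - a₂) (w + a₃)`. -/
def a2 (psi : ℂ) (a1 : ℝ) : ℝ :=
  (betaConst psi a1 / 2 - a1 +
    √((betaConst psi a1 / 2 - a1) ^ 2 + 4 * a1 * (betaConst psi a1 / 2 - a1))) / 2

def a3 (psi : ℂ) (a1 : ℝ) : ℝ :=
  (-(betaConst psi a1 / 2 - a1) +
    √((betaConst psi a1 / 2 - a1) ^ 2 + 4 * a1 * (betaConst psi a1 / 2 - a1))) / 2

/-- The complete elliptic integral of the first kind, as a function of `m = k²`. -/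
def ellipticK (m : ℝ) : ℝ := ∫ t in (0 : ℝ)..(Real.pi / 2), 1 / √(1 - m * Real.sin t ^ 2)

/-- `T = K(k) / r` with `k² = (a₁ - a₂) / (a₁ + a₃)` and `r = √(2 (a₁ + a₃))`. -/
def halfPeriod (psi : ℂ) (a1 : ℝ) : ℝ :=
  ellipticK ((a1 - a2 psi a1) / (a1 + a3 psi a1)) / √(2 * (a1 + a3 psi a1))

/-- `β₂(y, λ) = ∫₀^y 2 e^u / (λ³ ψ̄ - λ⁻³ ψ - e^u u') ds`. For `|λ| = 1` the denominator has
imaginary part `-2 Im (λ⁻³ ψ)`, so it has no zeros when `λ⁻³ ψ` is not real. -/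
def beta2 (psi lam : ℂ) (u : ℝ → ℝ) (y : ℝ) : ℂ :=
  ∫ s in (0 : ℝ)..y, (2 * Real.exp (u s) : ℂ) /
    (lam ^ 3 * conj psi - lam⁻¹ ^ 3 * psi - (Real.exp (u s) * deriv u s : ℝ))

end

end EquivMinLag

open EquivMinLag

/-! Write `w = e^u`, `a = Re (λ⁻³ψ)`, `b = Im (λ⁻³ψ)`, so that the associated surface has Hopf
coefficient `b - i a`. Its horizontal lift `G` solves a linear system for `(G, G_x, G_y)` whose
coefficients depend only on `y` (`isFrame`), and `w` satisfies `w'² = 4βw² - 8w³ - 4|ψ|²`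
(`isProfile`). On the line `y = 0` the system in `x` has a constant matrix, whose eigenvalues `i
d_j` are the roots of `d³ - βd + 2a = 0`; these are also the eigenvalues of `D(λ)`
(`potential_charpoly_eq`).

If the `d_j` are distinct, three independent linear functionals turn `G` into functions `e^{i d_j x}
g_j(y)` (`exists_eigenfunctions`). For `b ≠ 0` each `g_j` obeys a scalar equation `g' = q g` with
`q` periodic of period `2T`. As `w` is even, `Re q` integrates to zero, so `g_j(y + 2T) = e^{iθ_j}
g_j(y)` (`multiplier`). For `b = 0` this equation is singular at critical points of `w`; there
reflections of the metric show that `θ_j ∈ πℤ` (`multiplier_real`).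

A translation by `v` is a period of the surface iff it multiplies `G` by a constant. It then
preserves the metric, and for nonconstant `w` this forces `Im v = 2Tn` with `n` an integer. So `s +
2Tn i` is a period iff the numbers `d_j s + nθ_j` agree modulo `2π`. The periods span `ℂ` over `ℝ`
iff there is a nonzero real one and one with `n ≠ 0` (`lattice_iff`). As `Σ d_j = 0`, the former
means that `d_0/d_1` is rational or `d_1 = 0`. For the latter, `θ_i - θ_j = (d_i² - d_j²) I + (d_i -
d_j) K` with `I = Im β₂(2T)`; eliminating `s`, and `K` along with it, leaves `I (d_0 - d_2)(d_1 -
d_2) = 3 I (d_0 d_1 + 2β/3)`, which has to be a rational multiple of `2π`. For `b = 0` the choice `n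
= 2`, `s = 0` always works.

A multiple eigenvalue forces `w` to be constant and `b = 0` (`flat_of_double_root`). The system then
has constant coefficients and is integrated explicitly; both sides of the equivalence are true. -/

namespace EquivMinLag

/-! ### Directional derivatives of maps on the complex plane -/

section PartialDerivatives

variable {V : Type*} [NormedAddCommGroup V] [NormedSpace ℝ V]

/-- The derivative of `F` in the direction `v`. -/
noncomputable def pd (v : ℂ) (F : ℂ → V) (z : ℂ) : V := fderiv ℝ F z v

lemma dx_eq_pd (F : ℂ → C3) : dx F = pd 1 F := rfl

lemma dy_eq_pd (F : ℂ → C3) : dy F = pd Complex.I F := rfl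

lemma contDiff_pd {F : ℂ → V} (hF : ContDiff ℝ ∞ F) (v : ℂ) : ContDiff ℝ ∞ (pd v F) :=
  (hF.fderiv_right (m := ∞) (by simp)).clm_apply contDiff_const

lemma diff_of_smooth {F : ℂ → V} (hF : ContDiff ℝ ∞ F) : Differentiable ℝ F :=
  hF.differentiable (by simp)

lemma pd_comm {F : ℂ → V} (hF : ContDiff ℝ ∞ F) (v w : ℂ) : pd v (pd w F) = pd w (pd v F) := by
  have key : ∀ v w z, pd v (pd w F) z = fderiv ℝ (fderiv ℝ F) z v w := by
    intro v w z
    have hd : DifferentiableAt ℝ (fderiv ℝ F) z :=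
      (hF.fderiv_right (m := ∞) (by simp)).differentiable (by simp) z
    change fderiv ℝ (fun y => fderiv ℝ F y w) z v = _
    rw [fderiv_clm_apply hd (differentiableAt_const _)]
    simp
  funext z
  rw [key, key]
  refine (hF.contDiffAt.isSymmSndFDerivAt ?_).eq v w
  rw [minSmoothness_of_isRCLikeNormedField]
  exact WithTop.coe_le_coe.2 le_top

lemma pd_const (c : V) (v : ℂ) : pd v (fun _ => c) = fun _ => 0 := by
  funext z; simp [pd]

lemma pd_add {F G : ℂ → V} (hF : Differentiable ℝ F) (hG : Differentiable ℝ G) (v z : ℂ) :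
    pd v (fun y => F y + G y) z = pd v F z + pd v G z := by
  unfold pd
  rw [fderiv_fun_add (hF z) (hG z)]; rfl

lemma pd_sub {F G : ℂ → V} (hF : Differentiable ℝ F) (hG : Differentiable ℝ G) (v z : ℂ) :
    pd v (fun y => F y - G y) z = pd v F z - pd v G z := by
  unfold pd
  rw [fderiv_fun_sub (hF z) (hG z)]; rfl

lemma pd_smul [NormedSpace ℂ V] [IsScalarTower ℝ ℂ V] {e : ℂ → ℂ} {F : ℂ → V}
    (he : Differentiable ℝ e) (hF : Differentiable ℝ F) (v z : ℂ) :
    pd v (fun y => e y • F y) z = e z • pd v F z + pd v e z • F z := by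
  unfold pd
  rw [fderiv_fun_smul (he z) (hF z)]; rfl

lemma pd_comp_add {F : ℂ → V} (v w z : ℂ) :
    pd v (fun y => F (w + y)) z = pd v F (w + z) := by
  unfold pd
  rw [fderiv_comp_add_left]

lemma pd_clm_comp {W : Type*} [NormedAddCommGroup W] [NormedSpace ℝ W] (L : V →L[ℝ] W)
    {F : ℂ → V} (hF : Differentiable ℝ F) (v z : ℂ) :
    pd v (fun y => L (F y)) z = L (pd v F z) := by
  unfold pd
  have := (L.hasFDerivAt.comp z (hF z).hasFDerivAt).fderiv
  change fderiv ℝ (L ∘ F) z v = _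
  rw [this]; rfl

lemma hasDerivAt_line {F : ℂ → V} (hF : Differentiable ℝ F) {γ : ℝ → ℂ} {v : ℂ} {t : ℝ}
    (hγ : HasDerivAt γ v t) : HasDerivAt (fun s => F (γ s)) (pd v F (γ t)) t :=
  (hF (γ t)).hasFDerivAt.comp_hasDerivAt t hγ

lemma pd_inner {W : Type*} [NormedAddCommGroup W] [InnerProductSpace ℂ W] {F G : ℂ → W}
    (hF : Differentiable ℝ F) (hG : Differentiable ℝ G) (v z : ℂ) :
    pd v (fun y => inner ℂ (F y) (G y)) z
      = inner ℂ (F z) (pd v G z) + inner ℂ (pd v F z) (G z) :=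
  fderiv_inner_apply ℂ (hF z) (hG z) v

lemma hasDerivAt_horizontal (x y : ℝ) :
    HasDerivAt (fun s : ℝ => ((s : ℂ) + y * Complex.I)) 1 x := by
  simpa using (Complex.ofRealCLM.hasDerivAt (x := x)).add_const ((y : ℂ) * Complex.I)

lemma hasDerivAt_vertical (x y : ℝ) :
    HasDerivAt (fun s : ℝ => ((x : ℂ) + s * Complex.I)) Complex.I y := by
  simpa using ((Complex.ofRealCLM.hasDerivAt (x := y)).mul_const Complex.I).const_add (x : ℂ)

lemma pd_eq_of_basis {F : ℂ → V} (hx : ∀ z, pd 1 F z = 0) (hy : ∀ z, pd Complex.I F z = 0)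
    (hF : Differentiable ℝ F) (z w : ℂ) : F z = F w := by
  refine is_const_of_fderiv_eq_zero (𝕜 := ℝ) hF (fun p => ?_) z w
  ext v
  have hv : v = v.re • (1 : ℂ) + v.im • Complex.I := by
    simp [Complex.re_add_im]
  have h1 : fderiv ℝ F p 1 = 0 := hx p
  have h2 : fderiv ℝ F p Complex.I = 0 := hy p
  rw [hv, map_add, map_smul, map_smul, h1, h2]
  simp

end PartialDerivatives

/-! ### Expansion in an orthogonal basis of `ℂ³` -/

lemma eq_sum_of_orthogonal {e₀ e₁ e₂ : C3} {r : ℝ} (hr : r ≠ 0)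
    (h00 : inner ℂ e₀ e₀ = (1 : ℂ)) (h11 : inner ℂ e₁ e₁ = (r : ℂ)) (h22 : inner ℂ e₂ e₂ = (r : ℂ))
    (h01 : inner ℂ e₀ e₁ = (0 : ℂ)) (h02 : inner ℂ e₀ e₂ = (0 : ℂ))
    (h12 : inner ℂ e₁ e₂ = (0 : ℂ)) (v : C3) :
    (r : ℂ) • v = (r * inner ℂ e₀ v) • e₀ + (inner ℂ e₁ v) • e₁ + (inner ℂ e₂ v) • e₂ := by
  have h10 : inner ℂ e₁ e₀ = (0 : ℂ) := by rw [← inner_conj_symm, h01, map_zero]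
  have h20 : inner ℂ e₂ e₀ = (0 : ℂ) := by rw [← inner_conj_symm, h02, map_zero]
  have h21 : inner ℂ e₂ e₁ = (0 : ℂ) := by rw [← inner_conj_symm, h12, map_zero]
  have hrc : (r : ℂ) ≠ 0 := by exact_mod_cast hr
  have hli : LinearIndependent ℂ ![e₀, e₁, e₂] := by
    rw [Fintype.linearIndependent_iff]
    intro g hg
    simp only [Fin.sum_univ_three, Matrix.cons_val_zero, Matrix.cons_val_one,
      Matrix.cons_val] at hg
    have k0 := congrArg (inner ℂ e₀) hg
    have k1 := congrArg (inner ℂ e₁) hg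
    have k2 := congrArg (inner ℂ e₂) hg
    simp only [inner_add_right, inner_smul_right, h00, h01, h02, h10, h11, h12, h20, h21, h22,
      inner_zero_right, mul_zero, add_zero, zero_add, mul_one, mul_eq_zero, hrc, or_false]
      at k0 k1 k2
    intro i
    fin_cases i <;> assumption
  have hspan : Submodule.span ℂ (Set.range ![e₀, e₁, e₂]) = ⊤ :=
    hli.span_eq_top_of_card_eq_finrank (by simp)
  have hv : v ∈ Submodule.span ℂ (Set.range ![e₀, e₁, e₂]) := hspan ▸ Submodule.mem_top
  obtain ⟨c, rfl⟩ := (Submodule.mem_span_range_iff_exists_fun ℂ).1 hv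
  simp only [Fin.sum_univ_three, Matrix.cons_val_zero, Matrix.cons_val_one,
      Matrix.cons_val, inner_add_right, inner_smul_right, h00, h01, h02, h10, h11, h12, h20, h21,
      h22, smul_add, smul_smul]
  simp [mul_comm]

/-! ### Structure equations of a minimal Lagrangian surface -/

/-- The squared speed `‖F_x‖²`, which is `2 e^u`. -/
noncomputable def speedSq (F : ℂ → C3) (z : ℂ) : ℝ := ‖pd 1 F z‖ ^ 2

lemma speedSq_eq_inner (F : ℂ → C3) (z : ℂ) :
    inner ℂ (pd 1 F z) (pd 1 F z) = (speedSq F z : ℂ) := by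
  rw [inner_self_eq_norm_sq_to_K]; simp [speedSq]

lemma contDiff_speedSq {F : ℂ → C3} (hF : ContDiff ℝ ∞ F) : ContDiff ℝ ∞ (speedSq F) :=
  (contDiff_pd hF 1).norm_sq ℝ

lemma pd_ofReal {e : ℂ → ℝ} (he : Differentiable ℝ e) (v z : ℂ) :
    pd v (fun y => (e y : ℂ)) z = (pd v e z : ℝ) :=
  pd_clm_comp Complex.ofRealCLM he v z

lemma pd_dz {F : ℂ → C3} (hF : ContDiff ℝ ∞ F) (v z : ℂ) :
    pd v (dz F) z = (1 / 2 : ℂ) • (pd v (pd 1 F) z - Complex.I • pd v (pd Complex.I F) z) := by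
  have h1 := diff_of_smooth (contDiff_pd hF 1)
  have h2 := diff_of_smooth (contDiff_pd hF Complex.I)
  change pd v (fun y => (1 / 2 : ℂ) • (pd 1 F y - Complex.I • pd Complex.I F y)) z = _
  rw [pd_smul (differentiable_const _) (h1.fun_sub (h2.fun_const_smul Complex.I)),
    pd_sub h1 (h2.fun_const_smul Complex.I), pd_smul (differentiable_const _) h2]
  simp [pd_const]

namespace IsMinimalLagrangian

variable {f : ℂ → CP2} {G : ℂ → C3}

lemma smooth (h : IsMinimalLagrangian f G) : ContDiff ℝ ∞ G := h.lift.smooth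

lemma speedSq_pos (h : IsMinimalLagrangian f G) (z : ℂ) : 0 < speedSq G z := by
  have := norm_pos_iff.2 (h.immersion z)
  unfold speedSq
  exact pow_pos this 2

lemma inner_self (h : IsMinimalLagrangian f G) (z : ℂ) : inner ℂ (G z) (G z) = (1 : ℂ) := by
  rw [inner_self_eq_norm_sq_to_K, h.lift.norm_eq_one]; simp

lemma inner_x (h : IsMinimalLagrangian f G) (z : ℂ) : inner ℂ (G z) (pd 1 G z) = (0 : ℂ) :=
  h.lift.horizontal_x z

lemma inner_y (h : IsMinimalLagrangian f G) (z : ℂ) :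
    inner ℂ (G z) (pd Complex.I G z) = (0 : ℂ) :=
  h.lift.horizontal_y z

lemma inner_x_y (h : IsMinimalLagrangian f G) (z : ℂ) :
    inner ℂ (pd 1 G z) (pd Complex.I G z) = (0 : ℂ) :=
  Complex.ext (h.conformal_angle z) (h.lagrangian z)

lemma inner_y_y (h : IsMinimalLagrangian f G) (z : ℂ) :
    inner ℂ (pd Complex.I G z) (pd Complex.I G z) = (speedSq G z : ℂ) := by
  have := h.conformal_norm z
  rw [dx_eq_pd, dy_eq_pd] at this
  rw [inner_self_eq_norm_sq_to_K, ← this]; simp [speedSq]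

lemma inner_pd_add (hG : ContDiff ℝ ∞ G) (u v w z : ℂ) {c : ℂ → ℂ}
    (h : ∀ z, inner ℂ (pd u G z) (pd v G z) = c z) :
    inner ℂ (pd u G z) (pd w (pd v G) z) + inner ℂ (pd w (pd u G) z) (pd v G z) = pd w c z := by
  rw [← pd_inner (diff_of_smooth (contDiff_pd hG u)) (diff_of_smooth (contDiff_pd hG v))]
  congr 1
  exact funext h

lemma inner_pd_pd (hG : ContDiff ℝ ∞ G) (v w z : ℂ)
    (h : ∀ z, inner ℂ (G z) (pd v G z) = (0 : ℂ)) :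
    inner ℂ (G z) (pd w (pd v G) z) = - inner ℂ (pd w G z) (pd v G z) := by
  have := pd_inner (diff_of_smooth hG) (diff_of_smooth (contDiff_pd hG v)) w z
  rw [funext h, pd_const] at this
  exact eq_neg_of_add_eq_zero_left this.symm

lemma inner_xx (h : IsMinimalLagrangian f G) (z : ℂ) :
    inner ℂ (G z) (pd 1 (pd 1 G) z) = -(speedSq G z : ℂ) := by
  rw [inner_pd_pd h.smooth 1 1 z h.inner_x, speedSq_eq_inner]

lemma inner_xy (h : IsMinimalLagrangian f G) (z : ℂ) :
    inner ℂ (G z) (pd 1 (pd Complex.I G) z) = (0 : ℂ) := by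
  rw [inner_pd_pd h.smooth Complex.I 1 z h.inner_y, h.inner_x_y, neg_zero]

lemma inner_yy (h : IsMinimalLagrangian f G) (z : ℂ) :
    inner ℂ (G z) (pd Complex.I (pd Complex.I G) z) = -(speedSq G z : ℂ) := by
  rw [inner_pd_pd h.smooth Complex.I Complex.I z h.inner_y, h.inner_y_y]

lemma differentiable_speedSq (h : IsMinimalLagrangian f G) : Differentiable ℝ (speedSq G) :=
  diff_of_smooth (contDiff_speedSq h.smooth)

/-- Derivatives of the metric coefficients, in terms of the second derivatives of the lift. -/
lemma first_order_relations (h : IsMinimalLagrangian f G) (z : ℂ) :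
    inner ℂ (pd Complex.I G z) (pd 1 (pd 1 G) z)
      = - conj (inner ℂ (pd 1 G z) (pd 1 (pd Complex.I G) z)) ∧
    inner ℂ (pd 1 G z) (pd Complex.I (pd Complex.I G) z)
      = - conj (inner ℂ (pd Complex.I G z) (pd 1 (pd Complex.I G) z)) ∧
    2 * (inner ℂ (pd 1 G z) (pd 1 (pd 1 G) z)).re = pd 1 (speedSq G) z ∧
    2 * (inner ℂ (pd 1 G z) (pd 1 (pd Complex.I G) z)).re = pd Complex.I (speedSq G) z ∧
    2 * (inner ℂ (pd Complex.I G z) (pd 1 (pd Complex.I G) z)).re = pd 1 (speedSq G) z ∧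
    2 * (inner ℂ (pd Complex.I G z) (pd Complex.I (pd Complex.I G) z)).re
      = pd Complex.I (speedSq G) z := by
  have hG := h.smooth
  have hc : pd Complex.I (pd 1 G) = pd 1 (pd Complex.I G) := pd_comm hG _ _
  have e1 := inner_pd_add hG 1 Complex.I 1 z h.inner_x_y
  have e2 := inner_pd_add hG 1 Complex.I Complex.I z h.inner_x_y
  have e3 := inner_pd_add hG 1 1 1 z (speedSq_eq_inner G)
  have e4 := inner_pd_add hG 1 1 Complex.I z (speedSq_eq_inner G)
  have e5 := inner_pd_add hG Complex.I Complex.I 1 z h.inner_y_y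
  have e6 := inner_pd_add hG Complex.I Complex.I Complex.I z h.inner_y_y
  rw [pd_const] at e1 e2
  rw [pd_ofReal h.differentiable_speedSq] at e3 e4 e5 e6
  rw [hc] at e2 e4
  rw [← inner_conj_symm (pd 1 (pd 1 G) z)] at e1 e3
  rw [← inner_conj_symm (pd 1 (pd Complex.I G) z)] at e2 e4 e5
  rw [← inner_conj_symm (pd Complex.I (pd Complex.I G) z)] at e6
  refine ⟨?_, ?_, ?_, ?_, ?_, ?_⟩
  · rw [← map_neg, ← eq_neg_of_add_eq_zero_right e1, Complex.conj_conj]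
  · exact eq_neg_of_add_eq_zero_left e2
  all_goals
    first
    | have := congrArg Complex.re e3; simp [-inner_conj_symm] at this; linarith
    | have := congrArg Complex.re e4; simp [-inner_conj_symm] at this; linarith
    | have := congrArg Complex.re e5; simp [-inner_conj_symm] at this; linarith
    | have := congrArg Complex.re e6; simp [-inner_conj_symm] at this; linarith

/-- Conformality makes `F_xx + F_yy` real-orthogonal to `F_x` and `F_y`, so the tangential
coefficients allowed by `minimal` vanish. The coefficient of `F` comes from differentiating
horizontality. -/
lemma laplacian (h : IsMinimalLagrangian f G) (z : ℂ) :
    pd Complex.I (pd Complex.I G) z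
      = (-2 * speedSq G z : ℂ) • G z - pd 1 (pd 1 G) z := by
  obtain ⟨r1, r2, r3, r4, r5, r6⟩ := h.first_order_relations z
  obtain ⟨a, b, c, hm⟩ := h.minimal z
  rw [dx_eq_pd, dy_eq_pd, dx_eq_pd, dy_eq_pd] at hm
  have hE := h.speedSq_pos z
  have k0 := congrArg (inner ℂ (G z)) hm
  have k1 := congrArg (fun v => (inner ℂ (pd 1 G z) v).re) hm
  have k2 := congrArg (fun v => (inner ℂ (pd Complex.I G z) v).re) hm
  have hx0 : inner ℂ (pd 1 G z) (G z) = (0 : ℂ) := by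
    rw [← inner_conj_symm, h.inner_x, map_zero]
  have hy0 : inner ℂ (pd Complex.I G z) (G z) = (0 : ℂ) := by
    rw [← inner_conj_symm, h.inner_y, map_zero]
  have hyx : inner ℂ (pd Complex.I G z) (pd 1 G z) = (0 : ℂ) := by
    rw [← inner_conj_symm, h.inner_x_y, map_zero]
  simp only [inner_add_right, inner_smul_right, h.inner_xx, h.inner_yy, h.inner_x, h.inner_y,
    h.inner_self, h.inner_x_y, h.inner_y_y, speedSq_eq_inner, hx0, hy0, hyx, r1, r2] at k0 k1 k2
  simp [-inner_conj_symm] at k0 k1 k2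
  have ha : a = 0 := by
    have : a * speedSq G z = 0 := by linarith
    exact (mul_eq_zero.1 this).resolve_right hE.ne'
  have hb : b = 0 := by
    have : b * speedSq G z = 0 := by linarith
    exact (mul_eq_zero.1 this).resolve_right hE.ne'
  rw [eq_sub_iff_add_eq', hm, ha, hb, ← k0]
  simp only [Complex.ofReal_zero, zero_smul, zero_add]
  congr 1; ring

/-- Once `F_yy` is eliminated by `laplacian`, `F_zz` equals `(F_xx - i F_xy)/2` up to a multiple of
`F`, which is orthogonal to `F_z̄`. -/
lemma hopf_eq (h : IsMinimalLagrangian f G) (z : ℂ) :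
    4 * hopf G z = inner ℂ (pd 1 G z + Complex.I • pd Complex.I G z)
      (pd 1 (pd 1 G) z - Complex.I • pd 1 (pd Complex.I G) z) := by
  have hG := h.smooth
  have hx0 : inner ℂ (pd 1 G z) (G z) = (0 : ℂ) := by
    rw [← inner_conj_symm, h.inner_x, map_zero]
  have hy0 : inner ℂ (pd Complex.I G z) (G z) = (0 : ℂ) := by
    rw [← inner_conj_symm, h.inner_y, map_zero]
  have hzz : dz (dz G) z = (1 / 2 : ℂ) • (pd 1 (pd 1 G) z - Complex.I • pd 1 (pd Complex.I G) z
      + (speedSq G z : ℂ) • G z) := by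
    have : dz (dz G) z = (1 / 2 : ℂ) • (pd 1 (dz G) z - Complex.I • pd Complex.I (dz G) z) := rfl
    rw [this, pd_dz hG, pd_dz hG, pd_comm hG Complex.I 1, h.laplacian]
    simp only [smul_sub, smul_add, smul_smul]
    have hII : Complex.I * Complex.I = -1 := Complex.I_mul_I
    match_scalars
    · linear_combination (-1 / 4 : ℂ) * hII
    · ring
    · linear_combination (-(speedSq G z : ℂ) / 2) * hII
  have hzb : dzbar G z = (1 / 2 : ℂ) • (pd 1 G z + Complex.I • pd Complex.I G z) := rfl
  rw [hopf, hzz, hzb]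
  simp only [inner_add_right, inner_sub_right, inner_smul_right, inner_add_left, inner_smul_left,
    hx0, hy0]
  simp [Complex.conj_ofNat]
  ring

/-- The second derivatives in terms of the metric and the Hopf differential. -/
lemma second_order_relations (h : IsMinimalLagrangian f G) (z : ℂ) :
    inner ℂ (pd 1 G z) (pd 1 (pd 1 G) z)
      = ⟨pd 1 (speedSq G) z / 2, 2 * (hopf G z).im⟩ ∧
    inner ℂ (pd Complex.I G z) (pd 1 (pd 1 G) z)
      = ⟨- pd Complex.I (speedSq G) z / 2, 2 * (hopf G z).re⟩ ∧
    inner ℂ (pd 1 G z) (pd 1 (pd Complex.I G) z)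
      = ⟨pd Complex.I (speedSq G) z / 2, 2 * (hopf G z).re⟩ ∧
    inner ℂ (pd Complex.I G z) (pd 1 (pd Complex.I G) z)
      = ⟨pd 1 (speedSq G) z / 2, -2 * (hopf G z).im⟩ := by
  obtain ⟨r1, r2, r3, r4, r5, r6⟩ := h.first_order_relations z
  have hH := h.hopf_eq z
  have hx0 : inner ℂ (pd 1 G z) (G z) = (0 : ℂ) := by
    rw [← inner_conj_symm, h.inner_x, map_zero]
  -- With `F_yy` eliminated, the four brackets named below satisfy `P = conj Q` and `S = -conj R`.
  -- Their real parts are derivatives of the metric, and the two remaining imaginary parts are read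
  -- off from `hopf_eq`.
  rw [h.laplacian, inner_sub_right, inner_smul_right, hx0, mul_zero, zero_sub, neg_inj] at r2
  simp only [inner_add_left, inner_sub_right, inner_smul_left, inner_smul_right] at hH
  generalize inner ℂ (pd 1 G z) (pd 1 (pd 1 G) z) = P at *
  generalize inner ℂ (pd Complex.I G z) (pd 1 (pd 1 G) z) = S at *
  generalize inner ℂ (pd 1 G z) (pd 1 (pd Complex.I G) z) = R at *
  generalize inner ℂ (pd Complex.I G z) (pd 1 (pd Complex.I G) z) = Q at *
  have hre := congrArg Complex.re hH
  have him := congrArg Complex.im hH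
  subst r1 r2
  simp at hre him r3 r4 r5
  refine ⟨?_, ?_, ?_, ?_⟩ <;> apply Complex.ext <;> simp <;> linarith

lemma speedSq_smul_eq (h : IsMinimalLagrangian f G) (z : ℂ) (v : C3) :
    (speedSq G z : ℂ) • v = (speedSq G z * inner ℂ (G z) v) • G z
      + (inner ℂ (pd 1 G z) v) • pd 1 G z + (inner ℂ (pd Complex.I G z) v) • pd Complex.I G z :=
  eq_sum_of_orthogonal (h.speedSq_pos z).ne' (h.inner_self z) (speedSq_eq_inner G z)
    (h.inner_y_y z) (h.inner_x z) (h.inner_y z) (h.inner_x_y z) v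

end IsMinimalLagrangian

/-! ### Uniqueness of horizontal lifts and consequences of equivariance -/

/-- Smooth maps into the unit sphere, horizontal for the Hopf fibration. -/
structure IsHorizontal (F : ℂ → C3) : Prop where
  smooth : ContDiff ℝ ∞ F
  norm_eq_one : ∀ z, ‖F z‖ = 1
  horizontal_x : ∀ z, inner ℂ (F z) (pd 1 F z) = (0 : ℂ)
  horizontal_y : ∀ z, inner ℂ (F z) (pd Complex.I F z) = (0 : ℂ)

lemma IsHorizontalLift.isHorizontal {f : ℂ → CP2} {F : ℂ → C3} (h : IsHorizontalLift f F) :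
    IsHorizontal F :=
  ⟨h.smooth, h.norm_eq_one, h.horizontal_x, h.horizontal_y⟩

lemma IsHorizontal.comp_add {F : ℂ → C3} (h : IsHorizontal F) (w : ℂ) :
    IsHorizontal (fun z => F (w + z)) where
  smooth := h.smooth.comp (contDiff_const.add contDiff_id)
  norm_eq_one z := h.norm_eq_one _
  horizontal_x z := by rw [pd_comp_add]; exact h.horizontal_x _
  horizontal_y z := by rw [pd_comp_add]; exact h.horizontal_y _

lemma pd_clm_complex {F : ℂ → C3} (hF : Differentiable ℝ F) (U : C3 →L[ℂ] C3) (v z : ℂ) :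
    pd v (fun y => U (F y)) z = U (pd v F z) :=
  pd_clm_comp (U.restrictScalars ℝ) hF v z

lemma IsHorizontal.unitary {F : ℂ → C3} (h : IsHorizontal F) (U : C3 →L[ℂ] C3)
    (hU : ∀ x y, inner ℂ (U x) (U y) = inner ℂ x y) :
    IsHorizontal (fun z => U (F z)) where
  smooth := (U.restrictScalars ℝ).contDiff.comp h.smooth
  norm_eq_one z := by
    rw [← h.norm_eq_one z, @norm_eq_sqrt_re_inner ℂ, hU, ← @norm_eq_sqrt_re_inner ℂ]
  horizontal_x z := by rw [pd_clm_complex (diff_of_smooth h.smooth), hU, h.horizontal_x]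
  horizontal_y z := by rw [pd_clm_complex (diff_of_smooth h.smooth), hU, h.horizontal_y]

/-- The factor is `⟨F, G⟩`. Since `G` is a multiple of `F`, horizontality of each map kills one of
the two terms in the derivative of this bracket, so the factor is constant. -/
lemma IsHorizontal.eq_smul_of_mem_span {F G : ℂ → C3} (hF : IsHorizontal F) (hG : IsHorizontal G)
    (h : ∀ z, G z ∈ Submodule.span ℂ {F z}) : ∃ c : ℂ, ‖c‖ = 1 ∧ ∀ z, G z = c • F z := by
  have hself : ∀ z, inner ℂ (F z) (F z) = (1 : ℂ) := fun z => by
    rw [inner_self_eq_norm_sq_to_K, hF.norm_eq_one]; simp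
  have he : ∀ z, G z = (inner ℂ (F z) (G z) : ℂ) • F z := by
    intro z
    obtain ⟨c, hc⟩ := Submodule.mem_span_singleton.1 (h z)
    rw [← hc, inner_smul_right, hself, mul_one]
  have hn : ∀ z, ‖(inner ℂ (F z) (G z) : ℂ)‖ = 1 := by
    intro z
    have := congrArg norm (he z)
    rw [norm_smul, hF.norm_eq_one, hG.norm_eq_one, mul_one] at this
    exact this.symm
  have hdF := diff_of_smooth hF.smooth
  have hdG := diff_of_smooth hG.smooth
  have hd : ∀ v z, inner ℂ (F z) (pd v F z) = (0 : ℂ) → inner ℂ (G z) (pd v G z) = (0 : ℂ) →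
      pd v (fun z => (inner ℂ (F z) (G z) : ℂ)) z = 0 := by
    intro v z h1 h2
    rw [pd_inner hdF hdG]
    have h3 : inner ℂ (pd v F z) (F z) = (0 : ℂ) := by rw [← inner_conj_symm, h1, map_zero]
    have hne : (inner ℂ (F z) (G z) : ℂ) ≠ 0 := by
      intro h0; have := hn z; rw [h0, norm_zero] at this; exact zero_ne_one this
    have h4 : inner ℂ (pd v F z) (G z) = (0 : ℂ) := by
      rw [he z, inner_smul_right, h3, mul_zero]
    rw [he z, inner_smul_left] at h2
    rw [(mul_eq_zero.1 h2).resolve_left (by simpa [-inner_conj_symm] using hne), h4, add_zero]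
  have hconst := pd_eq_of_basis (fun z => hd 1 z (hF.horizontal_x z) (hG.horizontal_x z))
    (fun z => hd Complex.I z (hF.horizontal_y z) (hG.horizontal_y z)) (hdF.inner ℂ hdG)
  refine ⟨inner ℂ (F 0) (G 0), hn 0, fun z => ?_⟩
  conv_lhs => rw [he z]
  rw [hconst z 0]

/-- A period of a map into the projective plane multiplies a horizontal lift by a constant. -/
lemma IsHorizontalLift.period_iff {f : ℂ → CP2} {F : ℂ → C3} (h : IsHorizontalLift f F) (w : ℂ) :
    (∀ z, f (z + w) = f z) ↔ ∃ c : ℂ, ‖c‖ = 1 ∧ ∀ z, F (z + w) = c • F z := by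
  constructor
  · intro hp
    have := h.isHorizontal.eq_smul_of_mem_span (h.isHorizontal.comp_add w) (fun z => by
      rw [← h.lifts, ← hp, add_comm z w, h.lifts]
      exact Submodule.mem_span_singleton_self _)
    simpa only [add_comm w] using this
  · rintro ⟨c, hc, hF⟩ z
    apply Projectivization.submodule_injective
    rw [h.lifts, h.lifts, hF]
    apply Submodule.span_singleton_smul_eq
    rw [isUnit_iff_ne_zero]
    intro h0; rw [h0, norm_zero] at hc; exact zero_ne_one hc

lemma inner_specialUnitary (U : Matrix.specialUnitaryGroup (Fin 3) ℂ) (x y : C3) :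
    inner ℂ (Matrix.toEuclideanLin (U : Matrix (Fin 3) (Fin 3) ℂ) x)
      (Matrix.toEuclideanLin (U : Matrix (Fin 3) (Fin 3) ℂ) y) = (inner ℂ x y : ℂ) := by
  rw [← LinearMap.adjoint_inner_right, ← Matrix.toEuclideanLin_conjTranspose_eq_adjoint]
  congr 1
  have hU : (U : Matrix (Fin 3) (Fin 3) ℂ).conjTranspose * (U : Matrix (Fin 3) (Fin 3) ℂ) = 1 :=
    (Matrix.mem_specialUnitaryGroup_iff.1 U.2).1.1
  ext i
  simp [Matrix.toLpLin_apply, hU]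

/-- Translations act on the horizontal lift of an equivariant surface by unitary maps. -/
lemma exists_unitary_translation {f : ℂ → CP2} {F : ℂ → C3} (h : IsHorizontalLift f F)
    (he : IsTranslationallyEquivariant f) (t : ℝ) :
    ∃ U : C3 →L[ℂ] C3, (∀ x y, inner ℂ (U x) (U y) = (inner ℂ x y : ℂ)) ∧
      ∀ z, F (t + z) = U (F z) := by
  obtain ⟨R, -, -, hR⟩ := he
  set U := LinearMap.toContinuousLinearMap
    (Matrix.toEuclideanLin (R t : Matrix (Fin 3) (Fin 3) ℂ)) with hUdef
  have hU : ∀ x y, inner ℂ (U x) (U y) = (inner ℂ x y : ℂ) := inner_specialUnitary (R t)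
  obtain ⟨c, hc, hcF⟩ := (h.isHorizontal.unitary U hU).eq_smul_of_mem_span
    (h.isHorizontal.comp_add t) (fun z => by
      have h1 : F (t + z) ∈ (f (t + z)).submodule := by
        rw [h.lifts]; exact Submodule.mem_span_singleton_self _
      rw [hR t z, h.lifts, Submodule.map_span, Set.image_singleton] at h1
      exact h1)
  refine ⟨c • U, fun x y => ?_, fun z => hcF z⟩
  simp only [smul_apply, inner_smul_left, inner_smul_right, hU]
  rw [← mul_assoc, mul_comm c, ← Complex.normSq_eq_conj_mul_self, Complex.normSq_eq_norm_sq, hc]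
  simp

lemma pd_translation {A : ℂ → C3} (hA : Differentiable ℝ A) {U : C3 →L[ℂ] C3} {w : ℂ}
    (h : ∀ z, A (w + z) = U (A z)) (v z : ℂ) : pd v A (w + z) = U (pd v A z) := by
  rw [← pd_comp_add, funext h, pd_clm_complex hA]

namespace IsMinimalLagrangian

variable {f : ℂ → CP2} {G : ℂ → C3}

/-- Both quantities are inner products of derivatives of the lift, and a real translation acts on
the lift by a fixed unitary map. -/
lemma equivariant_invariants (h : IsMinimalLagrangian f G) (he : IsTranslationallyEquivariant f)
    (t : ℝ) (z : ℂ) : speedSq G (t + z) = speedSq G z ∧ hopf G (t + z) = hopf G z := by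
  obtain ⟨U, hU, hG⟩ := exists_unitary_translation h.lift he t
  have h1 := fun v => pd_translation (diff_of_smooth h.smooth) hG v
  have h2 := fun v w => pd_translation (diff_of_smooth (contDiff_pd h.smooth v)) (h1 v) w
  constructor
  · have : (speedSq G (t + z) : ℂ) = speedSq G z := by
      rw [← speedSq_eq_inner, ← speedSq_eq_inner, h1, hU]
    exact_mod_cast this
  · have : 4 * hopf G (t + z) = 4 * hopf G z := by
      rw [h.hopf_eq, h.hopf_eq, h1, h1, h2, h2, ← map_smul, ← map_smul, ← map_add, ← map_sub, hU]
    exact mul_left_cancel₀ (by norm_num) this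

/-- The Hopf differential satisfies the Cauchy-Riemann equations. -/
lemma hopf_holomorphic (h : IsMinimalLagrangian f G) (z : ℂ) :
    pd 1 (hopf G) z + Complex.I * pd Complex.I (hopf G) z = 0 ∧ Differentiable ℝ (hopf G) := by
  have hG := h.smooth
  have hGx := contDiff_pd hG 1
  have hGy := contDiff_pd hG Complex.I
  have hGxx := contDiff_pd hGx 1
  have hGxy := contDiff_pd hGy 1
  have dx' := diff_of_smooth hGx
  have dy' := diff_of_smooth hGy
  have dxx := diff_of_smooth hGxx
  have dxy := diff_of_smooth hGxy
  have hE := h.differentiable_speedSq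
  have hcI : Differentiable ℝ (fun _ : ℂ => Complex.I) := differentiable_const _
  set V : ℂ → C3 := fun z => pd 1 G z + Complex.I • pd Complex.I G z with hV
  set U : ℂ → C3 := fun z => pd 1 (pd 1 G) z - Complex.I • pd 1 (pd Complex.I G) z with hU
  have dV : Differentiable ℝ V := dx'.fun_add (dy'.fun_const_smul _)
  have dU : Differentiable ℝ U := dxx.fun_sub (dxy.fun_const_smul _)
  have hHf : hopf G = fun z => (1 / 4 : ℂ) * inner ℂ (V z) (U z) := by
    funext z
    rw [hV, hU, ← h.hopf_eq z]; ring
  have hHd : Differentiable ℝ (hopf G) := by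
    rw [hHf]; exact (dV.inner ℂ dU).const_mul _
  refine ⟨?_, hHd⟩
  have hHp : ∀ v, pd v (hopf G) z
      = (1 / 4 : ℂ) * (inner ℂ (V z) (pd v U z) + inner ℂ (pd v V z) (U z)) := by
    intro v
    rw [← pd_inner dV dU, hHf]
    have := pd_smul (differentiable_const (1 / 4 : ℂ)) (dV.inner ℂ dU) v z
    simp only [smul_eq_mul, pd_const, zero_mul, add_zero] at this
    exact this
  have hVp : ∀ v, pd v V z = pd v (pd 1 G) z + Complex.I • pd v (pd Complex.I G) z := by
    intro v
    rw [hV, pd_add dx' (dy'.fun_const_smul _), pd_smul hcI dy', pd_const]; simp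
  have hUp : ∀ v, pd v U z
      = pd v (pd 1 (pd 1 G)) z - Complex.I • pd v (pd 1 (pd Complex.I G)) z := by
    intro v
    rw [hU, pd_sub dxx (dxy.fun_const_smul _), pd_smul hcI dxy, pd_const]; simp
  have hlap : pd 1 (pd Complex.I (pd Complex.I G)) z
      = (-2 * speedSq G z : ℂ) • pd 1 G z + (-2 * pd 1 (speedSq G) z : ℂ) • G z
        - pd 1 (pd 1 (pd 1 G)) z := by
    have hd1 : Differentiable ℝ (fun y => (speedSq G y : ℂ)) :=
      Complex.ofRealCLM.differentiable.comp hE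
    have hd2 : Differentiable ℝ (fun y => (-2 * speedSq G y : ℂ)) := hd1.const_mul _
    have hp : pd 1 (fun y => (-2 * speedSq G y : ℂ)) z = -2 * pd 1 (speedSq G) z := by
      have := pd_smul (differentiable_const (-2 : ℂ)) hd1 1 z
      simp only [smul_eq_mul, pd_const, zero_mul, add_zero] at this
      rw [this, pd_ofReal hE]
    rw [funext h.laplacian, pd_sub (hd2.fun_smul (diff_of_smooth hG)) dxx,
      pd_smul hd2 (diff_of_smooth hG), hp]
  have c1 : pd Complex.I (pd 1 (pd 1 G)) z = pd 1 (pd 1 (pd Complex.I G)) z := by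
    rw [pd_comm hGx, pd_comm hG]
  have c2 : pd Complex.I (pd 1 (pd Complex.I G)) z = pd 1 (pd Complex.I (pd Complex.I G)) z := by
    rw [pd_comm hGy]
  have c3 : pd Complex.I (pd 1 G) z = pd 1 (pd Complex.I G) z := by rw [pd_comm hG]
  have hII : Complex.I * Complex.I = -1 := Complex.I_mul_I
  -- Here `V = 2 F_z̄`, and `U` is `2 F_zz` up to a multiple of `F`. As the inner product is
  -- conjugate-linear in its first slot, the `z̄`-derivative of `⟨V, U⟩` is `⟨V, U_z̄⟩ + ⟨V_z, U⟩`;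
  -- the two contributions cancel in `t1` and `t2`.
  have hUz : pd 1 U z + Complex.I • pd Complex.I U z
      = (-2 * speedSq G z : ℂ) • pd 1 G z + (-2 * pd 1 (speedSq G) z : ℂ) • G z := by
    rw [hUp, hUp, c1, c2, hlap]
    simp only [smul_sub, smul_add, smul_smul]
    match_scalars <;> first
      | ring1
      | linear_combination hII
      | linear_combination -hII
      | linear_combination (2 * speedSq G z : ℂ) * hII
      | linear_combination (2 * pd 1 (speedSq G) z : ℂ) * hII
  have hVz : pd 1 V z - Complex.I • pd Complex.I V z = (-2 * speedSq G z : ℂ) • G z := by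
    rw [hVp, hVp, h.laplacian, c3]
    simp only [smul_sub, smul_add, smul_smul]
    match_scalars <;> first
      | ring1
      | linear_combination hII
      | linear_combination -hII
      | linear_combination (2 * speedSq G z : ℂ) * hII
  have hx0 : inner ℂ (pd 1 G z) (G z) = (0 : ℂ) := by
    rw [← inner_conj_symm, h.inner_x, map_zero]
  have hy0 : inner ℂ (pd Complex.I G z) (G z) = (0 : ℂ) := by
    rw [← inner_conj_symm, h.inner_y, map_zero]
  have hyx : inner ℂ (pd Complex.I G z) (pd 1 G z) = (0 : ℂ) := by
    rw [← inner_conj_symm, h.inner_x_y, map_zero]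
  have t1 : inner ℂ (V z) (pd 1 U z) + Complex.I * inner ℂ (V z) (pd Complex.I U z)
      = -2 * (speedSq G z : ℂ) ^ 2 := by
    rw [← inner_smul_right, ← inner_add_right, hUz, hV]
    simp only [inner_add_left, inner_add_right, inner_smul_left, inner_smul_right, hx0, hy0, hyx,
      speedSq_eq_inner]
    ring
  have t2 : inner ℂ (pd 1 V z) (U z) + Complex.I * inner ℂ (pd Complex.I V z) (U z)
      = 2 * (speedSq G z : ℂ) ^ 2 := by
    have : inner ℂ (pd 1 V z) (U z) + Complex.I * inner ℂ (pd Complex.I V z) (U z)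
        = inner ℂ (pd 1 V z - Complex.I • pd Complex.I V z) (U z) := by
      rw [inner_sub_left, inner_smul_left, Complex.conj_I]; ring
    rw [this, hVz, hU]
    simp only [inner_sub_right, inner_smul_left, inner_smul_right, h.inner_xx, h.inner_xy]
    simp [Complex.conj_ofNat]
    ring
  rw [hHp, hHp]
  linear_combination (1 / 4 : ℂ) * (t1 + t2)

/-- Invariance under real translations kills the `x`-derivative, and the Cauchy-Riemann equation
then kills the `y`-derivative. -/
lemma hopf_const (h : IsMinimalLagrangian f G) (he : IsTranslationallyEquivariant f) (z : ℂ) :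
    hopf G z = hopf G 0 := by
  have hd := (h.hopf_holomorphic 0).2
  have hx : ∀ z, pd 1 (hopf G) z = 0 := by
    intro z
    have hγ : HasDerivAt (fun s : ℝ => (s : ℂ) + z) 1 (0 : ℝ) := by
      simpa using (Complex.ofRealCLM.hasDerivAt (x := (0 : ℝ))).add_const z
    have h1 := hasDerivAt_line hd hγ
    rw [funext fun s : ℝ => (h.equivariant_invariants he s z).2] at h1
    simpa using h1.unique (hasDerivAt_const (0 : ℝ) (hopf G z))
  refine pd_eq_of_basis hx (fun z => ?_) hd z 0
  have := (h.hopf_holomorphic z).1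
  rw [hx z, zero_add] at this
  exact (mul_eq_zero.1 this).resolve_left Complex.I_ne_zero

/-- The Gauss equation for a metric invariant under real translations. -/
lemma gauss (h : IsMinimalLagrangian f G) {H : ℂ} (hH : ∀ z, hopf G z = H)
    (hE : ∀ z, pd 1 (speedSq G) z = 0) (z : ℂ) :
    speedSq G z * pd Complex.I (pd Complex.I (speedSq G)) z
      = -2 * speedSq G z ^ 3 + pd Complex.I (speedSq G) z ^ 2 + 16 * ‖H‖ ^ 2 := by
  have hG := h.smooth
  have hGx := contDiff_pd hG 1
  have hGy := contDiff_pd hG Complex.I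
  have hGxx := contDiff_pd hGx 1
  have dx' := diff_of_smooth hGx
  have hdE := h.differentiable_speedSq
  obtain ⟨hP, hS, hR, hQ⟩ := h.second_order_relations z
  have hPc : (fun z => (inner ℂ (pd 1 G z) (pd 1 (pd 1 G) z) : ℂ))
      = fun _ => (⟨0, 2 * H.im⟩ : ℂ) := by
    funext z
    rw [(h.second_order_relations z).1, hE, hH, zero_div]
  have hRc : (fun z => (inner ℂ (pd 1 G z) (pd 1 (pd Complex.I G) z) : ℂ))
      = fun z => (1 / 2 : ℂ) • ((pd Complex.I (speedSq G) z : ℝ) : ℂ) + 2 * H.re * Complex.I := by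
    funext z
    rw [(h.second_order_relations z).2.2.1, hH]
    apply Complex.ext <;> simp
    ring
  -- Differentiate `⟨F_x, F_xx⟩` in `x` and `⟨F_x, F_xy⟩` in `y`. By `hlap` the third derivatives
  -- cancel in the sum, which leaves `|F_xx|² + |F_xy|²`; `n1` and `n2` compute these norms in the
  -- orthogonal frame.
  have k1 := pd_inner dx' (diff_of_smooth hGxx) 1 z
  rw [hPc, pd_const] at k1
  have k2 := pd_inner dx' (diff_of_smooth (contDiff_pd hGy 1)) Complex.I z
  have dEy : Differentiable ℝ (pd Complex.I (speedSq G)) :=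
    diff_of_smooth (contDiff_pd (contDiff_speedSq hG) _)
  have dEyc : Differentiable ℝ (fun z => ((pd Complex.I (speedSq G) z : ℝ) : ℂ)) :=
    Complex.ofRealCLM.differentiable.comp dEy
  rw [hRc, pd_add (dEyc.fun_const_smul _) (differentiable_const _), pd_const,
    pd_smul (differentiable_const _) dEyc, pd_ofReal dEy, pd_const, pd_comm hGy Complex.I 1,
    pd_comm hG Complex.I 1] at k2
  have hlap : pd 1 (pd Complex.I (pd Complex.I G)) z
      = (-2 * speedSq G z : ℂ) • pd 1 G z - pd 1 (pd 1 (pd 1 G)) z := by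
    have hd1 : Differentiable ℝ (fun y => (speedSq G y : ℂ)) :=
      Complex.ofRealCLM.differentiable.comp hdE
    have hd2 : Differentiable ℝ (fun y => (-2 * speedSq G y : ℂ)) := hd1.const_mul _
    have hp : pd 1 (fun y => (-2 * speedSq G y : ℂ)) z = 0 := by
      have := pd_smul (differentiable_const (-2 : ℂ)) hd1 1 z
      simp only [smul_eq_mul, pd_const, zero_mul, add_zero] at this
      rw [this, pd_ofReal hdE, hE]; simp
    rw [funext h.laplacian, pd_sub (hd2.fun_smul (diff_of_smooth hG)) (diff_of_smooth hGxx),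
      pd_smul hd2 (diff_of_smooth hG), hp]
    simp
  rw [hlap, inner_sub_right, inner_smul_right, speedSq_eq_inner] at k2
  have n1 := congrArg (fun v => (inner ℂ v (pd 1 (pd 1 G) z) : ℂ)) (h.speedSq_smul_eq z (pd 1 (pd 1 G) z))
  have n2 := congrArg (fun v => (inner ℂ v (pd 1 (pd Complex.I G) z) : ℂ))
    (h.speedSq_smul_eq z (pd 1 (pd Complex.I G) z))
  simp only [inner_add_left, inner_smul_left, hP, hQ, hR, hS, h.inner_xx, h.inner_xy, hE, hH]
    at n1 n2
  rw [inner_self_eq_norm_sq_to_K] at k1 k2 n1 n2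
  have k1' := congrArg Complex.re k1
  have k2' := congrArg Complex.re k2
  have n1' := congrArg Complex.re n1
  have n2' := congrArg Complex.re n2
  have hn : ‖H‖ ^ 2 = H.re ^ 2 + H.im ^ 2 := by
    rw [← Complex.normSq_eq_norm_sq, Complex.normSq_apply]; ring
  simp [-inner_conj_symm, ← Complex.ofReal_pow] at k1' k2' n1' n2'
  rw [hn]
  linear_combination (2 * speedSq G z) * k2' + (2 * speedSq G z) * k1' + 2 * n1' + 2 * n2'

end IsMinimalLagrangian

/-! ### The metric profile and the linear system along the coordinate lines -/

/-- A function `w = e^u` with derivative `w'` solving the Gauss equation together with its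
first integral, and with a critical point at the origin. -/
structure IsProfile (w w' : ℝ → ℝ) (β m : ℝ) : Prop where
  pos : ∀ y, 0 < w y
  deriv_fst : ∀ y, HasDerivAt w (w' y) y
  deriv_snd : ∀ y, HasDerivAt w' (4 * β * w y - 12 * w y ^ 2) y
  energy : ∀ y, w' y ^ 2 = 4 * β * w y ^ 2 - 8 * w y ^ 3 - 4 * m
  crit : w' 0 = 0

/-- A scalar solution `X`, with first derivatives `P` and `Q`, of the linear system satisfied by
the components of a horizontal lift, the cubic form being given by the constants `a` and `b`. -/
structure IsFrame (w w' : ℝ → ℝ) (a b : ℝ) (X P Q : ℝ → ℝ → ℂ) : Prop where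
  x : ∀ x y, HasDerivAt (fun s => X s y) (P x y) x
  y : ∀ x y, HasDerivAt (X x) (Q x y) y
  px : ∀ x y, HasDerivAt (fun s => P s y)
    ((-2 * w y : ℂ) * X x y - (Complex.I * a / w y) * P x y
      + ((-w' y / 2 + Complex.I * b) / w y) * Q x y) x
  py : ∀ x y, HasDerivAt (P x)
    (((w' y / 2 + Complex.I * b) / w y) * P x y + (Complex.I * a / w y) * Q x y) y
  qx : ∀ x y, HasDerivAt (fun s => Q s y)
    (((w' y / 2 + Complex.I * b) / w y) * P x y + (Complex.I * a / w y) * Q x y) x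
  qy : ∀ x y, HasDerivAt (Q x)
    ((-2 * w y : ℂ) * X x y + (Complex.I * a / w y) * P x y
      + ((w' y / 2 - Complex.I * b) / w y) * Q x y) y

/-- The quotient `(w'² + 8w³ + 4m)/w²` is a first integral, and its value at the critical point `0`
is `4β`. Using it to remove `w'²` makes the second-order equation polynomial in `w`. -/
lemma isProfile_of_gauss {w w' w'' : ℝ → ℝ} {m : ℝ} (hpos : ∀ y, 0 < w y)
    (h1 : ∀ y, HasDerivAt w (w' y) y) (h2 : ∀ y, HasDerivAt w' (w'' y) y) (h0 : w' 0 = 0)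
    (hg : ∀ y, w y * w'' y = w' y ^ 2 - 4 * w y ^ 3 + 4 * m) :
    IsProfile w w' (2 * w 0 + m / w 0 ^ 2) m := by
  have hder : ∀ y, HasDerivAt (fun y => (w' y ^ 2 + 8 * w y ^ 3 + 4 * m) / w y ^ 2) 0 y := by
    intro y
    have hw := (hpos y).ne'
    have := ((((h2 y).pow 2).add (((h1 y).pow 3).const_mul 8)).add_const (4 * m)).div
      ((h1 y).pow 2) (pow_ne_zero 2 hw)
    refine this.congr_deriv ?_
    rw [div_eq_zero_iff]
    left
    simp
    linear_combination (2 * w y * w' y) * hg y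
  have hconst : ∀ y, (w' y ^ 2 + 8 * w y ^ 3 + 4 * m) / w y ^ 2
      = 4 * (2 * w 0 + m / w 0 ^ 2) := by
    intro y
    have := is_const_of_deriv_eq_zero (fun y => (hder y).differentiableAt)
      (fun y => (hder y).deriv) y 0
    rw [this, h0]
    have hw := (hpos 0).ne'
    field_simp
    ring
  have hen : ∀ y, w' y ^ 2 = 4 * (2 * w 0 + m / w 0 ^ 2) * w y ^ 2 - 8 * w y ^ 3 - 4 * m := by
    intro y
    have hw := (hpos y).ne'
    have := hconst y
    rw [div_eq_iff (pow_ne_zero 2 hw)] at this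
    linarith
  refine ⟨hpos, h1, fun y => ?_, hen, h0⟩
  convert h2 y using 1
  have hw := (hpos y).ne'
  apply mul_left_cancel₀ hw
  rw [hg, hen]
  ring

namespace IsMinimalLagrangian

variable {f : ℂ → CP2} {G : ℂ → C3}

lemma norm_dz_sq (h : IsMinimalLagrangian f G) (z : ℂ) : ‖dz G z‖ ^ 2 = speedSq G z / 2 := by
  have hz : dz G z = (1 / 2 : ℂ) • (pd 1 G z - Complex.I • pd Complex.I G z) := rfl
  have hyx : inner ℂ (pd Complex.I G z) (pd 1 G z) = (0 : ℂ) := by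
    rw [← inner_conj_symm, h.inner_x_y, map_zero]
  have : ((‖dz G z‖ ^ 2 : ℝ) : ℂ) = (speedSq G z / 2 : ℝ) := by
    push_cast
    refine Eq.trans (Eq.symm (inner_self_eq_norm_sq_to_K (𝕜 := ℂ) (dz G z))) ?_
    rw [hz]
    simp only [inner_sub_left, inner_sub_right, inner_smul_left, inner_smul_right, h.inner_x_y,
      hyx, h.inner_y_y, speedSq_eq_inner]
    simp [Complex.conj_ofNat]
    linear_combination (-(1 / 4 : ℂ) * speedSq G z) * Complex.I_mul_I
  exact_mod_cast this

lemma exp_logFactor (h : IsMinimalLagrangian f G) (z : ℂ) :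
    Real.exp (logFactor G z) = speedSq G z / 2 := by
  rw [logFactor, h.norm_dz_sq, Real.exp_log]
  exact half_pos (h.speedSq_pos z)

/-- A minimal Lagrangian surface with metric depending only on `y` and constant Hopf
differential `b - i a` satisfies the linear system. -/
lemma isFrame (h : IsMinimalLagrangian f G) {a b : ℝ} {w w' : ℝ → ℝ}
    (hH : ∀ z, hopf G z = b - Complex.I * a)
    (hw : ∀ x y : ℝ, speedSq G (x + y * Complex.I) = 2 * w y)
    (hw' : ∀ x y : ℝ, pd Complex.I (speedSq G) (x + y * Complex.I) = 2 * w' y)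
    (hE : ∀ z, pd 1 (speedSq G) z = 0) (L : C3 →L[ℂ] ℂ) :
    IsFrame w w' a b (fun x y => L (G (x + y * Complex.I)))
      (fun x y => L (pd 1 G (x + y * Complex.I)))
      (fun x y => L (pd Complex.I G (x + y * Complex.I))) := by
  have hG := h.smooth
  have hGx := diff_of_smooth (contDiff_pd hG 1)
  have hGy := diff_of_smooth (contDiff_pd hG Complex.I)
  have hor : ∀ {A : ℂ → C3}, Differentiable ℝ A → ∀ x y : ℝ, HasDerivAt
      (fun s : ℝ => L (A (s + y * Complex.I))) (L (pd 1 A (x + y * Complex.I))) x :=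
    fun hA x y => (L.restrictScalars ℝ).hasFDerivAt.comp_hasDerivAt x
      (hasDerivAt_line hA (hasDerivAt_horizontal x y))
  have ver : ∀ {A : ℂ → C3}, Differentiable ℝ A → ∀ x y : ℝ, HasDerivAt
      (fun s : ℝ => L (A (x + s * Complex.I))) (L (pd Complex.I A (x + y * Complex.I))) y :=
    fun hA x y => (L.restrictScalars ℝ).hasFDerivAt.comp_hasDerivAt y
      (hasDerivAt_line hA (hasDerivAt_vertical x y))
  have hwc : ∀ y, (w y : ℂ) ≠ 0 := by
    intro y
    have := h.speedSq_pos ((0 : ℝ) + y * Complex.I)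
    rw [hw] at this
    have : 0 < w y := by linarith
    exact_mod_cast this.ne'
  have hxx : ∀ x y : ℝ, L (pd 1 (pd 1 G) (x + y * Complex.I))
      = (-2 * w y : ℂ) * L (G (x + y * Complex.I))
        - (Complex.I * a / w y) * L (pd 1 G (x + y * Complex.I))
        + ((-w' y / 2 + Complex.I * b) / w y) * L (pd Complex.I G (x + y * Complex.I)) := by
    intro x y
    have key := congrArg L (h.speedSq_smul_eq (x + y * Complex.I)
      (pd 1 (pd 1 G) (x + y * Complex.I)))
    obtain ⟨hP, hS, -, -⟩ := h.second_order_relations (x + y * Complex.I)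
    rw [hP, hS, h.inner_xx, hE, hH, hw, hw'] at key
    simp only [map_add, map_smul, smul_eq_mul] at key
    rw [Complex.mk_eq_add_mul_I, Complex.mk_eq_add_mul_I] at key
    have hwy := hwc y
    apply mul_left_cancel₀ (mul_ne_zero two_ne_zero hwy)
    simp at key
    rw [key]
    field_simp
    ring
  have hxy : ∀ x y : ℝ, L (pd 1 (pd Complex.I G) (x + y * Complex.I))
      = ((w' y / 2 + Complex.I * b) / w y) * L (pd 1 G (x + y * Complex.I))
        + (Complex.I * a / w y) * L (pd Complex.I G (x + y * Complex.I)) := by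
    intro x y
    have key := congrArg L (h.speedSq_smul_eq (x + y * Complex.I)
      (pd 1 (pd Complex.I G) (x + y * Complex.I)))
    obtain ⟨-, -, hR, hQ⟩ := h.second_order_relations (x + y * Complex.I)
    rw [hR, hQ, h.inner_xy, hE, hH, hw, hw'] at key
    simp only [map_add, map_smul, smul_eq_mul] at key
    rw [Complex.mk_eq_add_mul_I, Complex.mk_eq_add_mul_I] at key
    have hwy := hwc y
    apply mul_left_cancel₀ (mul_ne_zero two_ne_zero hwy)
    simp at key
    rw [key]
    field_simp
  refine ⟨hor (diff_of_smooth hG), ver (diff_of_smooth hG), fun x y => ?_, fun x y => ?_,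
    fun x y => ?_, fun x y => ?_⟩
  · rw [← hxx]; exact hor hGx x y
  · rw [← hxy, ← pd_comm hG Complex.I 1]; exact ver hGx x y
  · rw [← hxy]; exact hor hGy x y
  · refine (ver hGy x y).congr_deriv ?_
    rw [h.laplacian, map_sub, map_smul, hxx, hw, smul_eq_mul]
    push_cast
    ring

end IsMinimalLagrangian

/-! ### Uniqueness for linear differential inequalities -/

section Uniqueness

variable {V : Type*} [NormedAddCommGroup V] [NormedSpace ℝ V]

/-- Grönwall's inequality; the continuous coefficient `K` is bounded on the compact interval `[0,
t]`. -/
lemma eq_zero_of_norm_deriv_le_forward {X X' : ℝ → V} {K : ℝ → ℝ} (hK : Continuous K)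
    (hX : ∀ t, HasDerivAt X (X' t) t) (hb : ∀ t, ‖X' t‖ ≤ K t * ‖X t‖) (h0 : X 0 = 0)
    {t : ℝ} (ht : 0 ≤ t) : X t = 0 := by
  obtain ⟨C, hC⟩ := (isCompact_Icc (a := (0 : ℝ)) (b := t)).bddAbove_image hK.continuousOn
  refine eq_zero_of_abs_deriv_le_mul_abs_self_of_eq_zero_right (K := C) (a := 0) (b := t)
    (fun s _ => (hX s).continuousAt.continuousWithinAt)
    (fun s _ => (hX s).hasDerivWithinAt) h0 (fun s hs => ?_) t ⟨ht, le_rfl⟩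
  exact (hb s).trans (mul_le_mul_of_nonneg_right
    (hC ⟨s, ⟨hs.1, hs.2.le⟩, rfl⟩) (norm_nonneg _))

lemma eq_zero_of_norm_deriv_le {X X' : ℝ → V} {K : ℝ → ℝ} (hK : Continuous K)
    (hX : ∀ t, HasDerivAt X (X' t) t) (hb : ∀ t, ‖X' t‖ ≤ K t * ‖X t‖) (h0 : X 0 = 0)
    (t : ℝ) : X t = 0 := by
  rcases le_total 0 t with ht | ht
  · exact eq_zero_of_norm_deriv_le_forward hK hX hb h0 ht
  · have := eq_zero_of_norm_deriv_le_forward (X := fun s => X (-s)) (X' := fun s => -X' (-s))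
      (K := fun s => K (-s)) (hK.comp continuous_neg)
      (fun s => by simpa [Function.comp_def] using (hX (-s)).scomp s (hasDerivAt_neg s))
      (fun s => by rw [norm_neg]; exact hb (-s)) (by simpa using h0) (neg_nonneg.2 ht)
    simpa using this

lemma pair_eq_zero_of_linear {A : Type*} [NormedAddCommGroup A] [NormedSpace ℝ A]
    {p q p' q' : ℝ → A} {K : ℝ → ℝ} (hK : Continuous K)
    (hp : ∀ t, HasDerivAt p (p' t) t) (hq : ∀ t, HasDerivAt q (q' t) t)
    (hbp : ∀ t, ‖p' t‖ ≤ K t * (‖p t‖ + ‖q t‖)) (hbq : ∀ t, ‖q' t‖ ≤ K t * (‖p t‖ + ‖q t‖))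
    (hp0 : p 0 = 0) (hq0 : q 0 = 0) (t : ℝ) : p t = 0 ∧ q t = 0 := by
  have hle : ∀ s, ‖p s‖ + ‖q s‖ ≤ 2 * ‖(p s, q s)‖ := fun s => by
    have h1 : ‖p s‖ ≤ ‖(p s, q s)‖ := norm_fst_le (p s, q s)
    have h2 : ‖q s‖ ≤ ‖(p s, q s)‖ := norm_snd_le (p s, q s)
    linarith
  have key : ∀ s, K s * (‖p s‖ + ‖q s‖) ≤ (2 * |K s|) * ‖(p s, q s)‖ := fun s => by
    have h1 : K s * (‖p s‖ + ‖q s‖) ≤ |K s| * (‖p s‖ + ‖q s‖) :=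
      mul_le_mul_of_nonneg_right (le_abs_self _) (by positivity)
    have h2 := mul_le_mul_of_nonneg_left (hle s) (abs_nonneg (K s))
    linarith
  have := eq_zero_of_norm_deriv_le (X := fun s => (p s, q s)) (X' := fun s => (p' s, q' s))
    (K := fun s => 2 * |K s|) (by fun_prop) (fun s => (hp s).prodMk (hq s))
    (fun s => by
      rw [Prod.norm_mk]
      exact max_le ((hbp s).trans (key s)) ((hbq s).trans (key s)))
    (by simp [hp0, hq0]) t
  exact ⟨congrArg Prod.fst this, congrArg Prod.snd this⟩

end Uniqueness

/-! ### Periodicity of the metric profile -/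

/-- The elliptic amplitude substitution: an antiderivative of `1 / (r √(1 - m sin²))`. -/
noncomputable def amplitudeTime (r m α : ℝ) : ℝ :=
  ∫ s in (0 : ℝ)..α, 1 / √(1 - m * Real.sin s ^ 2) / r

/-- Negative `m` has to be allowed: if the origin is a minimum of the metric rather than a maximum,
then `a₁ < a₂` and `k²` is negative. -/
lemma continuous_ellipticIntegrand {m : ℝ} (hm : m < 1) :
    (∀ s, 0 < 1 - m * Real.sin s ^ 2) ∧
      Continuous fun s => 1 / √(1 - m * Real.sin s ^ 2) := by
  have hpos : ∀ s, 0 < 1 - m * Real.sin s ^ 2 := by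
    intro s
    have h1 := Real.sin_sq_le_one s
    have h2 := sq_nonneg (Real.sin s)
    rcases le_total m 0 with h0 | h0
    · nlinarith
    · have := mul_le_mul_of_nonneg_left h1 h0
      linarith
  refine ⟨hpos, continuous_const.div (by fun_prop) fun s => ?_⟩
  exact (Real.sqrt_pos.2 (hpos s)).ne'

section Amplitude

variable {r m : ℝ}

lemma hasDerivAt_amplitudeTime (hm : m < 1) (α : ℝ) :
    HasDerivAt (amplitudeTime r m) (1 / √(1 - m * Real.sin α ^ 2) / r) α := by
  have hc := (continuous_ellipticIntegrand hm).2.div_const r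
  exact intervalIntegral.integral_hasDerivAt_right (hc.intervalIntegrable _ _)
    (hc.stronglyMeasurableAtFilter _ _) hc.continuousAt

lemma amplitudeTime_strictMono (hr : 0 < r) (hm : m < 1) : StrictMono (amplitudeTime r m) := by
  refine strictMono_of_deriv_pos fun α => ?_
  rw [(hasDerivAt_amplitudeTime hm α).deriv]
  have := (continuous_ellipticIntegrand hm).1 α
  positivity

lemma amplitudeTime_zero : amplitudeTime r m 0 = 0 := by simp [amplitudeTime]

lemma amplitudeTime_neg (α : ℝ) : amplitudeTime r m (-α) = -amplitudeTime r m α := by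
  have := intervalIntegral.integral_comp_neg (a := 0) (b := α)
    (fun s => 1 / √(1 - m * Real.sin s ^ 2) / r)
  simp only [Real.sin_neg, neg_sq, neg_zero] at this
  rw [amplitudeTime, intervalIntegral.integral_symm, ← this, amplitudeTime]

lemma amplitudeTime_pi (hm : m < 1) : amplitudeTime r m Real.pi = 2 * (ellipticK m / r) := by
  have hc := (continuous_ellipticIntegrand hm).2.div_const r
  have h1 : ∫ s in (Real.pi / 2)..Real.pi, 1 / √(1 - m * Real.sin s ^ 2) / r
      = ∫ s in (0 : ℝ)..(Real.pi / 2), 1 / √(1 - m * Real.sin s ^ 2) / r := by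
    have := intervalIntegral.integral_comp_sub_left (a := 0) (b := Real.pi / 2)
      (fun s => 1 / √(1 - m * Real.sin s ^ 2) / r) Real.pi
    simp only [Real.sin_pi_sub, sub_zero] at this
    rw [this]
    congr 1
    ring
  rw [amplitudeTime, ← intervalIntegral.integral_add_adjacent_intervals
    (hc.intervalIntegrable 0 (Real.pi / 2)) (hc.intervalIntegrable (Real.pi / 2) Real.pi), h1,
    ← two_mul, intervalIntegral.integral_div, ellipticK]

lemma amplitudeTime_add_pi (hm : m < 1) (α : ℝ) :
    amplitudeTime r m (α + Real.pi) = amplitudeTime r m α + 2 * (ellipticK m / r) := by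
  have hc := (continuous_ellipticIntegrand hm).2.div_const r
  have hp : Function.Periodic (fun s => 1 / √(1 - m * Real.sin s ^ 2) / r) Real.pi := by
    intro s
    simp only [Real.sin_add_pi, neg_sq]
  have h1 := hp.intervalIntegral_add_eq α 0
  rw [zero_add] at h1
  rw [← amplitudeTime_pi hm, amplitudeTime, amplitudeTime, amplitudeTime, ← h1,
    intervalIntegral.integral_add_adjacent_intervals (hc.intervalIntegrable _ _)
    (hc.intervalIntegrable _ _)]

lemma amplitudeTime_int_mul_pi (hm : m < 1) (n : ℤ) :
    amplitudeTime r m (n * Real.pi) = n * (2 * (ellipticK m / r)) := by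
  induction n with
  | zero => simp [amplitudeTime_zero]
  | succ n ih =>
    push_cast at ih ⊢
    rw [add_mul, one_mul, amplitudeTime_add_pi hm, ih]; ring
  | pred n ih =>
    have := amplitudeTime_add_pi (r := r) hm ((-(n : ℝ) - 1) * Real.pi)
    push_cast at ih ⊢
    rw [show (-(n : ℝ) - 1) * Real.pi + Real.pi = -(n : ℝ) * Real.pi by ring, ih] at this
    linarith

lemma ellipticK_div_pos (hr : 0 < r) (hm : m < 1) : 0 < ellipticK m / r := by
  have := amplitudeTime_strictMono hr hm Real.pi_pos
  rw [amplitudeTime_zero, amplitudeTime_pi hm] at this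
  linarith

/-- Each step of `π` in the amplitude adds the fixed positive amount `2K/r`, so the values are
unbounded in both directions and the intermediate value theorem applies. -/
lemma amplitudeTime_surjective (hr : 0 < r) (hm : m < 1) :
    Function.Surjective (amplitudeTime r m) := by
  have hT := ellipticK_div_pos hr hm
  have hcont : Continuous (amplitudeTime r m) :=
    continuous_iff_continuousAt.2 fun α => (hasDerivAt_amplitudeTime hm α).continuousAt
  intro y
  obtain ⟨n, hn⟩ := exists_nat_gt (|y| / (2 * (ellipticK m / r)))
  rw [div_lt_iff₀ (by positivity)] at hn
  have h1 := amplitudeTime_int_mul_pi (r := r) hm n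
  have h2 := amplitudeTime_int_mul_pi (r := r) hm (-n)
  push_cast at h1 h2
  have hy := abs_lt.1 hn
  have hmem : y ∈ Set.Icc (amplitudeTime r m (-(n : ℝ) * Real.pi))
      (amplitudeTime r m (n * Real.pi)) := by
    rw [h1, h2]; constructor <;> linarith
  have hle : -(n : ℝ) * Real.pi ≤ n * Real.pi := by
    have : 0 ≤ (n : ℝ) * Real.pi := by positivity
    linarith
  obtain ⟨α, -, hα⟩ := intermediate_value_Icc hle hcont.continuousOn hmem
  exact ⟨α, hα⟩

end Amplitude

/-- Elementary relations between the roots of the cubic. -/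
lemma root_relations {psi : ℂ} (hpsi : psi ≠ 0) {a1 : ℝ} (ha1 : 0 < a1) :
    0 < a2 psi a1 ∧ 0 < a3 psi a1 ∧
      betaConst psi a1 = 2 * (a1 + a2 psi a1 - a3 psi a1) ∧
      a1 * a2 psi a1 = a3 psi a1 * (a1 + a2 psi a1) := by
  set c := betaConst psi a1 / 2 - a1 with hc
  have hcpos : 0 < c := by
    have : c = ‖psi‖ ^ 2 / a1 ^ 2 / 2 := by rw [hc, betaConst]; ring
    rw [this]
    have := norm_pos_iff.2 hpsi
    positivity
  have hs : 0 ≤ c ^ 2 + 4 * a1 * c := by positivity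
  have hsq := Real.sq_sqrt hs
  have hgt : c < √(c ^ 2 + 4 * a1 * c) := by
    apply Real.lt_sqrt_of_sq_lt
    have : 0 < 4 * a1 * c := by positivity
    linarith
  have e2 : a2 psi a1 = (c + √(c ^ 2 + 4 * a1 * c)) / 2 := rfl
  have e3 : a3 psi a1 = (-c + √(c ^ 2 + 4 * a1 * c)) / 2 := rfl
  rw [e2, e3]
  refine ⟨by linarith, by linarith, ?_, ?_⟩
  · have : betaConst psi a1 = 2 * (c + a1) := by rw [hc]; ring
    rw [this]; ring
  · nlinarith

namespace IsProfile

variable {w w' : ℝ → ℝ} {β m : ℝ}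

/-- Explicit form of the profile in terms of the elliptic amplitude. -/
lemma comp_amplitudeTime (h : IsProfile w w' β m) {A B r k : ℝ} (hA : 0 < A) (hB : 0 < B)
    (hβ : β = 2 * (w 0 + A - B)) (hrel : w 0 * A = B * (w 0 + A))
    (hr : r = √(2 * (w 0 + B))) (hk : k = (w 0 - A) / (w 0 + B)) (α : ℝ) :
    k < 1 ∧ w (amplitudeTime r k α) = w 0 - (w 0 - A) * Real.sin α ^ 2 := by
  set a := w 0 with ha
  have ha0 : 0 < a := h.pos 0
  have hk1 : k < 1 := by
    rw [hk, div_lt_one (by positivity)]; linarith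
  refine ⟨hk1, ?_⟩
  have hr0 : 0 < r := by rw [hr]; positivity
  have hr2 : r ^ 2 = 2 * (a + B) := by rw [hr, Real.sq_sqrt]; positivity
  have hkm : (a + B) * k = a - A := by rw [hk]; field_simp
  obtain ⟨hpos, hcont⟩ := continuous_ellipticIntegrand hk1
  set q : ℝ → ℝ := fun α => √(1 - k * Real.sin α ^ 2) with hq
  have hq0 : ∀ α, 0 < q α := fun α => Real.sqrt_pos.2 (hpos α)
  have hq2 : ∀ α, q α ^ 2 = 1 - k * Real.sin α ^ 2 := fun α => Real.sq_sqrt (hpos α).le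
  set Y := amplitudeTime r k with hY
  have hYd : ∀ α, HasDerivAt Y (1 / q α / r) α := hasDerivAt_amplitudeTime hk1
  have hYc : Continuous Y := continuous_iff_continuousAt.2 fun α => (hYd α).continuousAt
  have hwc : Continuous w := continuous_iff_continuousAt.2 fun α => (h.deriv_fst α).continuousAt
  -- `S` is the expected value of `w` at amplitude `α`, and `S2` is its derivative with respect to
  -- `y = Y α`. The pairs `(w ∘ Y, w' ∘ Y)` and `(S, S2)` solve the same first-order system in `α`
  -- with the same initial values.
  set S : ℝ → ℝ := fun α => a - (a - A) * Real.sin α ^ 2 with hS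
  set S2 : ℝ → ℝ := fun α => -(a - A) * (2 * Real.sin α * Real.cos α) * (r * q α) with hS2
  have hSd : ∀ α, HasDerivAt S (1 / q α / r * S2 α) α := by
    intro α
    have h1 := (((Real.hasDerivAt_sin α).pow 2).const_mul (a - A)).const_sub a
    refine h1.congr_deriv ?_
    have := (hq0 α).ne'
    rw [hS2]
    field_simp
    norm_num
    ring
  have hqd : ∀ α, HasDerivAt q (-(k * (Real.sin α * Real.cos α)) / q α) α := by
    intro α
    have h1 := ((((Real.hasDerivAt_sin α).pow 2).const_mul k).const_sub 1).sqrt (hpos α).ne'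
    refine h1.congr_deriv ?_
    have := (hq0 α).ne'
    change _ / (2 * q α) = _
    field_simp
    norm_num
    ring
  have hS2d : ∀ α, HasDerivAt S2 (1 / q α / r * (4 * β * S α - 12 * S α ^ 2)) α := by
    intro α
    have h1 := ((((Real.hasDerivAt_sin α).const_mul 2).mul (Real.hasDerivAt_cos α)).const_mul
      (-(a - A))).mul ((hqd α).const_mul r)
    refine h1.congr_deriv ?_
    have hqq := (hq0 α).ne'
    have hcos : Real.cos α ^ 2 = 1 - Real.sin α ^ 2 := by
      have := Real.sin_sq_add_cos_sq α; linarith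
    apply mul_left_cancel₀ (mul_ne_zero hqq hr0.ne')
    have e1 : q α * r * (1 / q α / r * (4 * β * S α - 12 * S α ^ 2))
        = 4 * β * S α - 12 * S α ^ 2 := by field_simp
    rw [e1]
    have e2 : q α * r * (-(a - A) * (2 * Real.cos α * Real.cos α + 2 * Real.sin α * -Real.sin α)
          * (r * q α) + -(a - A) * (2 * Real.sin α * Real.cos α)
          * (r * (-(k * (Real.sin α * Real.cos α)) / q α)))
        = -(a - A) * (2 * (Real.cos α ^ 2 - Real.sin α ^ 2)) * (r ^ 2 * q α ^ 2)
          + 2 * (a - A) * k * r ^ 2 * Real.sin α ^ 2 * Real.cos α ^ 2 := by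
      field_simp
      ring
    refine e2.trans ?_
    have e3 : r ^ 2 * q α ^ 2 = 2 * (a + B) - 2 * (a - A) * Real.sin α ^ 2 := by
      rw [hr2, hq2, ← hkm]; ring
    have e4 : k * r ^ 2 = 2 * (a - A) := by rw [hr2, ← hkm]; ring
    rw [e3, hcos, mul_assoc (2 * (a - A)), e4, hβ, hS]
    linear_combination (-4 : ℝ) * hrel
  -- The nonlinearity `4βw - 12w²` is quadratic, so its difference at `w ∘ Y` and `S` is a
  -- continuous function times `w ∘ Y - S`. Uniqueness thus reduces to a linear differential
  -- inequality.
  have key := pair_eq_zero_of_linear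
    (p := fun α => w (Y α) - S α) (q := fun α => w' (Y α) - S2 α)
    (p' := fun α => 1 / q α / r * (w' (Y α) - S2 α))
    (q' := fun α => 1 / q α / r * ((4 * β - 12 * (w (Y α) + S α)) * (w (Y α) - S α)))
    (K := fun α => 1 / q α / r * (1 + |4 * β - 12 * (w (Y α) + S α)|)) (by fun_prop)
    (fun α => by
      refine (((h.deriv_fst (Y α)).comp α (hYd α)).sub (hSd α)).congr_deriv ?_
      ring)
    (fun α => by
      refine (((h.deriv_snd (Y α)).comp α (hYd α)).sub (hS2d α)).congr_deriv ?_
      ring)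
    (fun α => by
      have := hq0 α
      rw [norm_mul, Real.norm_of_nonneg (by positivity), mul_assoc]
      refine mul_le_mul_of_nonneg_left ?_ (by positivity)
      nlinarith [norm_nonneg (w' (Y α) - S2 α), norm_nonneg (w (Y α) - S α),
        mul_nonneg (abs_nonneg (4 * β - 12 * (w (Y α) + S α))) (norm_nonneg (w' (Y α) - S2 α)),
        mul_nonneg (abs_nonneg (4 * β - 12 * (w (Y α) + S α))) (norm_nonneg (w (Y α) - S α))])
    (fun α => by
      have := hq0 α
      rw [norm_mul, norm_mul, Real.norm_of_nonneg (by positivity), mul_assoc,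
        Real.norm_eq_abs (4 * β - 12 * (w (Y α) + S α))]
      refine mul_le_mul_of_nonneg_left ?_ (by positivity)
      nlinarith [norm_nonneg (w' (Y α) - S2 α), norm_nonneg (w (Y α) - S α),
        mul_nonneg (abs_nonneg (4 * β - 12 * (w (Y α) + S α))) (norm_nonneg (w' (Y α) - S2 α)),
        mul_nonneg (abs_nonneg (4 * β - 12 * (w (Y α) + S α))) (norm_nonneg (w (Y α) - S α))])
    (by simp [hY, hS, amplitudeTime_zero, ← ha])
    (by simp [hY, hS2, amplitudeTime_zero, h.crit]) α
  have := key.1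
  simp only [hS] at this
  linarith

/-- The profile is even and `2T`-periodic, and `2T` is its smallest period unless it is
constant. -/
lemma periodicity {psi : ℂ} (hpsi : psi ≠ 0) (h : IsProfile w w' (betaConst psi (w 0)) m) :
    0 < halfPeriod psi (w 0) ∧ (∀ y, w (y + 2 * halfPeriod psi (w 0)) = w y) ∧
      (∀ y, w (-y) = w y) ∧
      ((∃ y, w y ≠ w 0) → ∀ p, w p = w 0 → ∃ n : ℤ, p = n * (2 * halfPeriod psi (w 0))) := by
  obtain ⟨hA, hB, hβ, hrel⟩ := root_relations hpsi (h.pos 0)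
  have hf := h.comp_amplitudeTime hA hB hβ hrel rfl rfl
  set r := √(2 * (w 0 + a3 psi (w 0))) with hr
  set k := (w 0 - a2 psi (w 0)) / (w 0 + a3 psi (w 0)) with hk
  have hk1 : k < 1 := (hf 0).1
  have hr0 : 0 < r := by have := h.pos 0; positivity
  have hT : halfPeriod psi (w 0) = ellipticK k / r := rfl
  have hsurj := amplitudeTime_surjective hr0 hk1
  rw [hT]
  refine ⟨ellipticK_div_pos hr0 hk1, fun y => ?_, fun y => ?_, fun hne p hp => ?_⟩
  · obtain ⟨α, rfl⟩ := hsurj y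
    rw [← amplitudeTime_add_pi hk1, (hf _).2, (hf _).2, Real.sin_add_pi, neg_sq]
  · obtain ⟨α, rfl⟩ := hsurj y
    rw [← amplitudeTime_neg, (hf _).2, (hf _).2, Real.sin_neg, neg_sq]
  · obtain ⟨α, rfl⟩ := hsurj p
    -- For `a₁ = a₂` the explicit formula is constant. Otherwise the value `w 0` is taken only where
    -- `sin α = 0`, that is at integer multiples of `2T`.
    have hA1 : w 0 - a2 psi (w 0) ≠ 0 := by
      intro h0
      obtain ⟨y, hy⟩ := hne
      obtain ⟨γ, rfl⟩ := hsurj y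
      apply hy
      rw [(hf γ).2, h0]; ring
    rw [(hf α).2, sub_eq_self, mul_eq_zero, or_iff_right hA1, sq_eq_zero_iff,
      Real.sin_eq_zero_iff] at hp
    obtain ⟨n, rfl⟩ := hp
    exact ⟨n, amplitudeTime_int_mul_pi hk1 n⟩

/-- A profile through the minimum of the potential is constant. -/
lemma eq_const (h : IsProfile w w' β m) {y₀ : ℝ} (h0 : w' y₀ = 0) (hm : w y₀ ^ 3 = m) (y : ℝ) :
    w y = w y₀ := by
  have hk := h.pos y₀
  have e0 := h.energy y₀
  have hβ : β = 3 * w y₀ := by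
    have : w y₀ ^ 2 * (β - 3 * w y₀) = 0 := by
      rw [h0] at e0; linear_combination (-1 / 4 : ℝ) * e0 - hm
    have := (mul_eq_zero.1 this).resolve_left (by positivity)
    linarith
  have e := h.energy y
  have hy := h.pos y
  rw [hβ, ← hm] at e
  -- With `β = 3 w(y₀)` and `m = w(y₀)³`, the right side of the energy identity is `-4 (w - w(y₀))²
  -- (2w + w(y₀))`, while the left side is a square.
  have h1 : (w y - w y₀) ^ 2 * (2 * w y + w y₀) ≤ 0 := by
    have := sq_nonneg (w' y)
    nlinarith
  have h2 : (w y - w y₀) ^ 2 ≤ 0 := by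
    by_contra hcon
    push Not at hcon
    have : 0 < (w y - w y₀) ^ 2 * (2 * w y + w y₀) := by positivity
    linarith
  have h3 := pow_eq_zero_iff (two_ne_zero) |>.1 (le_antisymm h2 (sq_nonneg _))
  linarith

lemma deriv_periodic (h : IsProfile w w' β m) {p : ℝ} (hp : ∀ y, w (y + p) = w y) (y : ℝ) :
    w' (y + p) = w' y := by
  have h1 := (h.deriv_fst (y + p)).comp_add_const y p
  rw [funext hp] at h1
  exact h1.unique (h.deriv_fst y)

lemma deriv_odd (h : IsProfile w w' β m) (hp : ∀ y, w (-y) = w y) (y : ℝ) :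
    w' (-y) = -w' y := by
  have h1 := (h.deriv_fst (-y)).scomp y (hasDerivAt_neg y)
  have h2 : w ∘ Neg.neg = w := funext hp
  rw [h2] at h1
  have := h1.unique (h.deriv_fst y)
  simp at this
  linarith

end IsProfile

/-! ### Separation of variables for the linear system -/

lemma linear_system_eq_zero {n : ℕ} {M : ℝ → Fin n → Fin n → ℂ}
    (hM : ∀ i j, Continuous fun t => M t i j) {v : ℝ → Fin n → ℂ}
    (hv : ∀ i t, HasDerivAt (fun s => v s i) (∑ j, M t i j * v t j) t) (h0 : v 0 = 0) (t : ℝ) :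
    v t = 0 := by
  refine eq_zero_of_norm_deriv_le (K := fun t => ∑ i, ∑ j, ‖M t i j‖)
    (X' := fun t i => ∑ j, M t i j * v t j) (by fun_prop)
    (fun t => hasDerivAt_pi.2 fun i => hv i t) (fun t => ?_) h0 t
  refine (pi_norm_le_iff_of_nonneg (by positivity)).2 fun i => ?_
  refine (norm_sum_le _ _).trans ?_
  have h1 : ∑ j, ‖M t i j‖ ≤ ∑ i, ∑ j, ‖M t i j‖ :=
    Finset.single_le_sum (f := fun i => ∑ j, ‖M t i j‖) (fun i _ => by positivity)
      (Finset.mem_univ i)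
  refine le_trans ?_ (mul_le_mul_of_nonneg_right h1 (norm_nonneg _))
  rw [Finset.sum_mul]
  refine Finset.sum_le_sum fun j _ => ?_
  rw [norm_mul]
  exact mul_le_mul_of_nonneg_left (norm_le_pi_norm _ _) (norm_nonneg _)

/-- The profile in `y` of a solution of the linear system which is proportional to `e^{i d x}`. -/
structure IsEigenfunction (w w' : ℝ → ℝ) (a b d : ℝ) (g g' : ℝ → ℂ) : Prop where
  deriv_fst : ∀ y, HasDerivAt g (g' y) y
  deriv_snd : ∀ y, HasDerivAt g' ((-2 * w y : ℂ) * g y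
    + (Complex.I * a / w y) * (Complex.I * d * g y) + ((w' y / 2 - Complex.I * b) / w y) * g' y) y
  rel_fst : ∀ y, (d ^ 2 * w y + a * d - 2 * w y ^ 2 : ℂ) * g y
    + (Complex.I * b - w' y / 2) * g' y = 0
  rel_snd : ∀ y, Complex.I * d * w y * g' y
    = (w' y / 2 + Complex.I * b) * (Complex.I * d * g y) + Complex.I * a * g' y

/-- The matrix of the linear system at the origin, acting on `(X, X_x, X_y)`. -/
noncomputable def originMatrix (w₀ a b : ℝ) : Matrix (Fin 3) (Fin 3) ℂ :=
  !![0, 1, 0;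
    -2 * w₀, -(Complex.I * a / w₀), Complex.I * b / w₀;
    0, Complex.I * b / w₀, Complex.I * a / w₀]

section Frames

variable {w w' : ℝ → ℝ} {a b : ℝ} {X P Q : ℝ → ℝ → ℂ}

lemma hasDerivAt_cexp_mul (d x : ℝ) :
    HasDerivAt (fun s : ℝ => Complex.exp (Complex.I * d * s))
      (Complex.I * d * Complex.exp (Complex.I * d * x)) x := by
  have h1 : HasDerivAt (fun s : ℝ => Complex.I * d * (s : ℂ)) (Complex.I * d) x := by
    simpa using (Complex.ofRealCLM.hasDerivAt (x := x)).const_mul (Complex.I * d)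
  exact h1.cexp.congr_deriv (mul_comm _ _)

/-- A solution whose initial data are an eigenvector is proportional to `e^{i d x}`. -/
lemma IsFrame.separation (h : IsFrame w w' a b X P Q) (hw0 : ∀ y, 0 < w y) (hw : Continuous w)
    (hw' : Continuous w') (hcrit : w' 0 = 0) {d : ℝ}
    (hev : (originMatrix (w 0) a b).mulVec ![X 0 0, P 0 0, Q 0 0]
      = (Complex.I * d) • ![X 0 0, P 0 0, Q 0 0]) (x y : ℝ) :
    X x y = Complex.exp (Complex.I * d * x) * X 0 y ∧
      P x y = Complex.exp (Complex.I * d * x) * P 0 y ∧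
      Q x y = Complex.exp (Complex.I * d * x) * Q 0 y := by
  have e0 := congrFun hev 0
  have e1 := congrFun hev 1
  have e2 := congrFun hev 2
  simp [originMatrix, Matrix.mulVec, dotProduct, Fin.sum_univ_three] at e0 e1 e2
  have hwc : ∀ y, (w y : ℂ) ≠ 0 := fun y => by exact_mod_cast (hw0 y).ne'
  -- First the line `y = 0`: since `w' 0 = 0`, the system in `x` has the constant matrix
  -- `originMatrix` there, and the difference from the exponential solution vanishes at `x = 0`.
  have base := linear_system_eq_zero (M := fun _ => originMatrix (w 0) a b)
    (v := fun x => ![X x 0 - Complex.exp (Complex.I * d * x) * X 0 0,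
      P x 0 - Complex.exp (Complex.I * d * x) * P 0 0,
      Q x 0 - Complex.exp (Complex.I * d * x) * Q 0 0]) (fun i j => continuous_const)
    (fun i t => by
      have hE := hasDerivAt_cexp_mul d t
      fin_cases i
      · refine ((h.x t 0).sub (hE.mul_const (X 0 0))).congr_deriv ?_
        simp [originMatrix, Fin.sum_univ_three]
        rw [e0]; ring
      · refine ((h.px t 0).sub (hE.mul_const (P 0 0))).congr_deriv ?_
        simp [originMatrix, Fin.sum_univ_three, hcrit]
        linear_combination Complex.exp (Complex.I * d * t) * e1
      · refine ((h.qx t 0).sub (hE.mul_const (Q 0 0))).congr_deriv ?_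
        simp [originMatrix, Fin.sum_univ_three, hcrit]
        linear_combination Complex.exp (Complex.I * d * t) * e2)
    (by funext i; fin_cases i <;> simp) x
  have b0 := congrFun base 0
  have b1 := congrFun base 1
  have b2 := congrFun base 2
  simp at b0 b1 b2
  have hwcc : Continuous fun y => (w y : ℂ) := by fun_prop
  have hwcc' : Continuous fun y => (w' y : ℂ) := by fun_prop
  -- Now the vertical lines: the system in `y` does not involve `x`, so the columns at `x` and at
  -- `0`, proportional at `y = 0`, remain proportional.
  have main := linear_system_eq_zero
    (M := fun y => (!![0, 0, 1;
      0, (w' y / 2 + Complex.I * b) / w y, Complex.I * a / w y;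
      -2 * w y, Complex.I * a / w y, (w' y / 2 - Complex.I * b) / w y] :
        Matrix (Fin 3) (Fin 3) ℂ))
    (v := fun y => ![X x y - Complex.exp (Complex.I * d * x) * X 0 y,
      P x y - Complex.exp (Complex.I * d * x) * P 0 y,
      Q x y - Complex.exp (Complex.I * d * x) * Q 0 y])
    (fun i j => by
      fin_cases i <;> fin_cases j <;> simp <;>
      first
      | exact continuous_const
      | exact Continuous.div (by fun_prop) hwcc hwc
      | fun_prop)
    (fun i t => by
      fin_cases i
      · refine ((h.y x t).sub ((h.y 0 t).const_mul _)).congr_deriv ?_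
        simp [Fin.sum_univ_three]
      · refine ((h.py x t).sub ((h.py 0 t).const_mul _)).congr_deriv ?_
        simp [Fin.sum_univ_three]
        ring
      · refine ((h.qy x t).sub ((h.qy 0 t).const_mul _)).congr_deriv ?_
        simp [Fin.sum_univ_three]
        ring)
    (by
      funext i
      fin_cases i
      · simpa using b0
      · simpa using b1
      · simpa using b2) y
  have m0 := congrFun main 0
  have m1 := congrFun main 1
  have m2 := congrFun main 2
  simp at m0 m1 m2
  exact ⟨sub_eq_zero.1 m0, sub_eq_zero.1 m1, sub_eq_zero.1 m2⟩

lemma IsFrame.isEigenfunction (h : IsFrame w w' a b X P Q) (hw0 : ∀ y, 0 < w y) {d : ℝ}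
    (hs : ∀ x y, X x y = Complex.exp (Complex.I * d * x) * X 0 y ∧
      P x y = Complex.exp (Complex.I * d * x) * P 0 y ∧
      Q x y = Complex.exp (Complex.I * d * x) * Q 0 y) :
    IsEigenfunction w w' a b d (X 0) (Q 0) ∧ ∀ y, P 0 y = Complex.I * d * X 0 y := by
  have hwc : ∀ y, (w y : ℂ) ≠ 0 := fun y => by exact_mod_cast (hw0 y).ne'
  have key : ∀ {A : ℝ → ℝ → ℂ} {y : ℝ} {A' : ℂ},
      (∀ x, A x y = Complex.exp (Complex.I * d * x) * A 0 y) →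
      HasDerivAt (fun s => A s y) A' 0 → A' = Complex.I * d * A 0 y := by
    intro A y A' hA hd
    have h1 := (hasDerivAt_cexp_mul d 0).mul_const (A 0 y)
    rw [← funext hA] at h1
    simpa using hd.unique h1
  have hP : ∀ y, P 0 y = Complex.I * d * X 0 y := fun y => key (fun x => (hs x y).1) (h.x 0 y)
  refine ⟨⟨h.y 0, fun y => ?_, fun y => ?_, fun y => ?_⟩, hP⟩
  · rw [← hP]; exact h.qy 0 y
  -- Replacing `∂_x` by `i d` turns the equations for `P_x` and `Q_x` into algebraic relations
  -- between `g` and `g'`. The first of them makes a scalar first-order equation available.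
  · have := key (fun x => (hs x y).2.1) (h.px 0 y)
    rw [hP] at this
    have hwy := hwc y
    field_simp at this
    linear_combination (1 / 2 : ℂ) * this
      + (a * d * X 0 y + d ^ 2 * w y * X 0 y) * Complex.I_mul_I
  · have := key (fun x => (hs x y).2.2) (h.qx 0 y)
    rw [hP] at this
    have hwy := hwc y
    field_simp at this
    linear_combination (-Complex.I / 2) * this

end Frames

/-- Eigenvectors of the system at the origin, for three distinct roots of the characteristic
equation. -/
lemma exists_eigenvectors {w₀ a b β : ℝ} (hw : 0 < w₀) (hβ : β = 2 * w₀ + (a ^ 2 + b ^ 2) / w₀ ^ 2)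
    {d : Fin 3 → ℝ} (hd : Function.Injective d) (hroot : ∀ j, d j ^ 3 - β * d j + 2 * a = 0) :
    ∃ l : Fin 3 → Fin 3 → ℂ,
      (∀ j, (originMatrix w₀ a b).mulVec (l j) = (Complex.I * d j) • l j ∧ l j ≠ 0) ∧
      ∀ v : Fin 3 → ℂ, (∀ j, ∑ k, l j k * v k = 0) → v = 0 := by
  have hwc : (w₀ : ℂ) ≠ 0 := by exact_mod_cast hw.ne'
  have hex : ∀ j, ∃ l : Fin 3 → ℂ, l ≠ 0 ∧
      (Matrix.scalar (Fin 3) (Complex.I * d j) - originMatrix w₀ a b).mulVec l = 0 := by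
    intro j
    rw [Matrix.exists_mulVec_eq_zero_iff]
    -- The characteristic polynomial of `originMatrix` at `i d` is `-i (d³ - βd + 2a)`.
    have hr : ((d j : ℂ) ^ 3 - (2 * w₀ + (a ^ 2 + b ^ 2) / w₀ ^ 2) * d j + 2 * a) = 0 := by
      have := hroot j
      rw [hβ] at this
      exact_mod_cast congrArg (Complex.ofReal) this
    have hI3 : Complex.I ^ 3 = -Complex.I := Complex.I_pow_three
    field_simp at hr
    rw [Matrix.det_fin_three]
    simp [originMatrix]
    field_simp
    linear_combination (-Complex.I) * hr
      + (Complex.I * ((d j : ℂ) ^ 3 * w₀ ^ 2 - d j * (a ^ 2 + b ^ 2))) * Complex.I_sq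
  choose l hl0 hl using hex
  have hev : ∀ j, (originMatrix w₀ a b).mulVec (l j) = (Complex.I * d j) • l j := by
    intro j
    have := hl j
    rw [Matrix.sub_mulVec, sub_eq_zero] at this
    rw [← this]
    ext i
    simp [Matrix.scalar_apply, Matrix.mulVec_diagonal]
  have hinj : Function.Injective fun j => Complex.I * (d j : ℂ) := by
    intro i j hij
    apply hd
    have := mul_left_cancel₀ Complex.I_ne_zero hij
    exact_mod_cast this
  have hli : LinearIndependent ℂ l :=
    Module.End.eigenvectors_linearIndependent' (Matrix.toLin' (originMatrix w₀ a b)) _ hinj l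
      (fun j => Module.End.hasEigenvector_iff.2
        ⟨Module.End.mem_eigenspace_iff.2 (by rw [Matrix.toLin'_apply]; exact hev j), hl0 j⟩)
  refine ⟨l, fun j => ⟨hev j, hl0 j⟩, fun v hv => ?_⟩
  have hu : IsUnit (Matrix.of l) := Matrix.linearIndependent_rows_iff_isUnit.1 hli
  apply Matrix.mulVec_injective_iff_isUnit.2 hu
  rw [Matrix.mulVec_zero]
  funext j
  exact hv j

namespace IsMinimalLagrangian

variable {f : ℂ → CP2} {G : ℂ → C3}

/-- Decomposition of the horizontal lift into eigenfunctions of the translations. -/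
lemma exists_eigenfunctions (h : IsMinimalLagrangian f G) {a b β m : ℝ} {w w' : ℝ → ℝ}
    (hprof : IsProfile w w' β m) (hβ : β = 2 * w 0 + (a ^ 2 + b ^ 2) / w 0 ^ 2)
    (hH : ∀ z, hopf G z = b - Complex.I * a)
    (hw : ∀ x y : ℝ, speedSq G (x + y * Complex.I) = 2 * w y)
    (hw' : ∀ x y : ℝ, pd Complex.I (speedSq G) (x + y * Complex.I) = 2 * w' y)
    (hE : ∀ z, pd 1 (speedSq G) z = 0)
    {d : Fin 3 → ℝ} (hd : Function.Injective d) (hroot : ∀ j, d j ^ 3 - β * d j + 2 * a = 0) :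
    ∃ g g' : Fin 3 → ℝ → ℂ, (∀ j, IsEigenfunction w w' a b (d j) (g j) (g' j)) ∧
      (∀ j, ∃ y, g j y ≠ 0) ∧
      ∀ (s p : ℝ) (c : ℂ), (∀ z, G (z + (s + p * Complex.I)) = c • G z) ↔
        ∀ j y, Complex.exp (Complex.I * d j * s) * g j (y + p) = c * g j y := by
  obtain ⟨l, hl, hsep⟩ := exists_eigenvectors (hprof.pos 0) hβ hd hroot
  have hE0 : (speedSq G 0 : ℂ) ≠ 0 := by exact_mod_cast (h.speedSq_pos 0).ne'
  have hwcont : Continuous w :=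
    continuous_iff_continuousAt.2 fun y => (hprof.deriv_fst y).continuousAt
  have hwcont' : Continuous w' :=
    continuous_iff_continuousAt.2 fun y => (hprof.deriv_snd y).continuousAt
  -- The `e k` form the basis dual to `(G, G_x, G_y)` at the origin, so `L j` sends that frame to
  -- the entries of the eigenvector `l j`. Each component `L j ∘ G` therefore has an eigenvector as
  -- initial data, and the three `L j` together separate points.
  set e : Fin 3 → C3 →L[ℂ] ℂ := ![innerSL ℂ (G 0), (speedSq G 0 : ℂ)⁻¹ • innerSL ℂ (pd 1 G 0),
    (speedSq G 0 : ℂ)⁻¹ • innerSL ℂ (pd Complex.I G 0)] with he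
  set L : Fin 3 → C3 →L[ℂ] ℂ := fun j => ∑ k, l j k • e k with hL
  have hLv : ∀ j v, L j v = ∑ k, l j k * e k v := by
    intro j v
    simp [hL]
  have hx0 : inner ℂ (pd 1 G 0) (G 0) = (0 : ℂ) := by
    rw [← inner_conj_symm, h.inner_x, map_zero]
  have hy0 : inner ℂ (pd Complex.I G 0) (G 0) = (0 : ℂ) := by
    rw [← inner_conj_symm, h.inner_y, map_zero]
  have hyx : inner ℂ (pd Complex.I G 0) (pd 1 G 0) = (0 : ℂ) := by
    rw [← inner_conj_symm, h.inner_x_y, map_zero]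
  have hzero : ((0 : ℝ) : ℂ) + ((0 : ℝ) : ℂ) * Complex.I = 0 := by simp
  have hinit : ∀ j, ![L j (G (((0 : ℝ) : ℂ) + ((0 : ℝ) : ℂ) * Complex.I)),
      L j (pd 1 G (((0 : ℝ) : ℂ) + ((0 : ℝ) : ℂ) * Complex.I)),
      L j (pd Complex.I G (((0 : ℝ) : ℂ) + ((0 : ℝ) : ℂ) * Complex.I))] = l j := by
    intro j
    rw [hzero]
    funext k
    fin_cases k <;>
      simp [hLv, he, Fin.sum_univ_three, h.inner_self, h.inner_x, h.inner_y, hx0, hy0, hyx,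
        h.inner_x_y, h.inner_y_y, speedSq_eq_inner, hE0, -inner_self_eq_norm_sq_to_K]
  have hLsep : ∀ v, (∀ j, L j v = 0) → v = 0 := by
    intro v hv
    have h1 := hsep (fun k => e k v) (fun j => by rw [← hLv]; exact hv j)
    have k0 : inner ℂ (G 0) v = (0 : ℂ) := congrFun h1 0
    have k1 : (speedSq G 0 : ℂ)⁻¹ * inner ℂ (pd 1 G 0) v = 0 := congrFun h1 1
    have k2 : (speedSq G 0 : ℂ)⁻¹ * inner ℂ (pd Complex.I G 0) v = 0 := congrFun h1 2
    have hinv := inv_ne_zero hE0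
    have h2 := h.speedSq_smul_eq 0 v
    rw [k0, (mul_eq_zero.1 k1).resolve_left hinv, (mul_eq_zero.1 k2).resolve_left hinv] at h2
    simp only [mul_zero, zero_smul, add_zero] at h2
    exact (smul_eq_zero.1 h2).resolve_left hE0
  have hfr := fun j => h.isFrame hH hw hw' hE (L j)
  have hs := fun j => (hfr j).separation hprof.pos hwcont hwcont' hprof.crit
    (d := d j) (by rw [hinit]; exact (hl j).1)
  have heig := fun j => (hfr j).isEigenfunction hprof.pos (hs j)
  refine ⟨_, _, fun j => (heig j).1, fun j => ?_, fun s p c => ?_⟩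
  -- If `g j` vanished identically, so would its derivative and `P = i d g`, hence all the initial
  -- data, which form the nonzero vector `l j`.
  · by_contra hcon
    push Not at hcon
    apply (hl j).2
    rw [← hinit j]
    have hQ : L j (pd Complex.I G (((0 : ℝ) : ℂ) + ((0 : ℝ) : ℂ) * Complex.I)) = 0 := by
      have h1 := (heig j).1.deriv_fst 0
      have h2 : HasDerivAt (fun y : ℝ => L j (G (((0 : ℝ) : ℂ) + y * Complex.I))) 0 0 := by
        rw [funext hcon]; exact hasDerivAt_const _ _
      exact h1.unique h2
    have hP := (heig j).2 0
    rw [hcon 0, mul_zero] at hP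
    rw [hQ, hP, hcon 0]
    funext k; fin_cases k <;> rfl
  · have hX : ∀ j (x y : ℝ), L j (G (x + y * Complex.I))
        = Complex.exp (Complex.I * d j * x) * L j (G (((0 : ℝ) : ℂ) + y * Complex.I)) :=
      fun j x y => (hs j x y).1
    constructor
    · intro hp j y
      have h1 := congrArg (L j) (hp (((0 : ℝ) : ℂ) + y * Complex.I))
      rw [map_smul, smul_eq_mul] at h1
      rw [← h1, ← hX]
      congr 2
      push_cast
      ring
    · intro hp z
      rw [← sub_eq_zero]
      apply hLsep
      intro j
      rw [map_sub, map_smul, smul_eq_mul, sub_eq_zero]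
      have hz : z = (z.re : ℂ) + z.im * Complex.I := (Complex.re_add_im z).symm
      have hz' : z + (s + p * Complex.I)
          = ((z.re + s : ℝ) : ℂ) + ((z.im + p : ℝ) : ℂ) * Complex.I := by
        conv_lhs => rw [hz]
        push_cast; ring
      rw [hz', hX]
      conv_rhs => rw [hz, hX]
      rw [mul_left_comm, ← hp j z.im, ← mul_assoc, ← Complex.exp_add]
      congr 2
      push_cast; ring

end IsMinimalLagrangian

/-! ### Multipliers of the eigenfunctions over a period of the metric -/

lemma eq_exp_integral_of_deriv_eq_mul {g q : ℝ → ℂ} (hq : Continuous q)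
    (hg : ∀ y, HasDerivAt g (q y * g y) y) (s t : ℝ) :
    g t = Complex.exp (∫ y in s..t, q y) * g s := by
  have hI : ∀ y, HasDerivAt (fun y => ∫ x in s..y, q x) (q y) y := fun y =>
    intervalIntegral.integral_hasDerivAt_right (hq.intervalIntegrable _ _)
      (hq.stronglyMeasurableAtFilter _ _) hq.continuousAt
  have hder : ∀ y, HasDerivAt (fun y => Complex.exp (-∫ x in s..y, q x) * g y) 0 y := by
    intro y
    refine ((hI y).neg.cexp.mul (hg y)).congr_deriv ?_
    simp only [Pi.neg_apply]
    ring
  have := is_const_of_deriv_eq_zero (fun y => (hder y).differentiableAt)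
    (fun y => (hder y).deriv) t s
  simp only [intervalIntegral.integral_same, neg_zero, Complex.exp_zero, one_mul] at this
  rw [← this, ← mul_assoc, ← Complex.exp_add]
  simp

lemma integral_eq_zero_of_antisymm {φ : ℝ → ℝ} {τ : ℝ} (h : ∀ y, φ (τ - y) = -φ y) :
    ∫ y in (0 : ℝ)..τ, φ y = 0 := by
  have h1 := intervalIntegral.integral_comp_sub_left (a := 0) (b := τ) φ τ
  simp only [h, sub_zero, sub_self, intervalIntegral.integral_neg] at h1
  linarith

lemma iterate_multiplier {g : ℝ → ℂ} {τ θ : ℝ}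
    (h : ∀ y, g (y + τ) = Complex.exp (Complex.I * θ) * g y) (n : ℤ) (y : ℝ) :
    g (y + n * τ) = Complex.exp (Complex.I * (n * θ)) * g y := by
  induction n with
  | zero => simp
  | succ n ih =>
    push_cast at ih ⊢
    rw [show y + ((n : ℝ) + 1) * τ = (y + n * τ) + τ by ring, h, ih, ← mul_assoc,
      ← Complex.exp_add]
    congr 2; ring
  | pred n ih =>
    have h1 := h (y + (-(n : ℝ) - 1) * τ)
    rw [show y + (-(n : ℝ) - 1) * τ + τ = y + -(n : ℝ) * τ by ring] at h1
    push_cast at ih ⊢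
    rw [h1] at ih
    have : Complex.exp (Complex.I * ((-(n : ℂ) - 1) * θ))
        = Complex.exp (-(Complex.I * θ)) * Complex.exp (Complex.I * (-(n : ℂ) * θ)) := by
      rw [← Complex.exp_add]; congr 1; ring
    rw [this, mul_assoc, ← ih, ← mul_assoc, ← Complex.exp_add]
    simp

section

variable {w w' : ℝ → ℝ} {β m a b d τ : ℝ} {g g' : ℝ → ℂ}

/-- The phase acquired by an eigenfunction over a period `τ` of the metric. -/
noncomputable def phase (w w' : ℝ → ℝ) (a b d τ : ℝ) : ℝ :=
  ∫ y in (0 : ℝ)..τ, 2 * b * (2 * d ^ 2 * w y + 2 * a * d - 4 * w y ^ 2) / (w' y ^ 2 + 4 * b ^ 2)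

lemma IsProfile.continuous_fst (h : IsProfile w w' β m) : Continuous w :=
  continuous_iff_continuousAt.2 fun y => (h.deriv_fst y).continuousAt

lemma IsProfile.continuous_snd (h : IsProfile w w' β m) : Continuous w' :=
  continuous_iff_continuousAt.2 fun y => (h.deriv_snd y).continuousAt

/-- The term `-4w²` in the phase does not involve `d` and cancels. Of the two integrals left over,
the first is `Im β₂` by `im_beta2`; the second will be absorbed into the real part of the period. -/
lemma phase_sub (h : IsProfile w w' β m) (hb : b ≠ 0) (d₁ d₂ : ℝ) :
    phase w w' a b d₁ τ - phase w w' a b d₂ τ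
      = (d₁ ^ 2 - d₂ ^ 2) * (∫ y in (0 : ℝ)..τ, 4 * b * w y / (w' y ^ 2 + 4 * b ^ 2))
        + (d₁ - d₂) * a * ∫ y in (0 : ℝ)..τ, 4 * b / (w' y ^ 2 + 4 * b ^ 2) := by
  have hD : ∀ y, w' y ^ 2 + 4 * b ^ 2 ≠ 0 := fun y => by positivity
  have c1 := h.continuous_fst
  have c2 := h.continuous_snd
  have i1 : Continuous fun y => 4 * b * w y / (w' y ^ 2 + 4 * b ^ 2) :=
    Continuous.div (by fun_prop) (by fun_prop) hD
  have i2 : Continuous fun y => 4 * b / (w' y ^ 2 + 4 * b ^ 2) :=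
    Continuous.div (by fun_prop) (by fun_prop) hD
  have i3 : ∀ d : ℝ, Continuous fun y =>
      2 * b * (2 * d ^ 2 * w y + 2 * a * d - 4 * w y ^ 2) / (w' y ^ 2 + 4 * b ^ 2) :=
    fun d => Continuous.div (by fun_prop) (by fun_prop) hD
  rw [phase, phase, ← intervalIntegral.integral_sub ((i3 d₁).intervalIntegrable _ _)
    ((i3 d₂).intervalIntegrable _ _), ← intervalIntegral.integral_const_mul,
    ← intervalIntegral.integral_const_mul,
    ← intervalIntegral.integral_add ((i1.const_mul _).intervalIntegrable _ _)
      ((i2.const_mul _).intervalIntegrable _ _)]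
  congr 1
  funext y
  have := hD y
  field_simp
  ring

namespace IsEigenfunction

/-- For `b ≠ 0` the relation `rel_fst` can be solved as `g' = N/(w' - 2ib) · g`. The real part `R`
of the quotient is odd under `y ↦ τ - y` and integrates to zero over a period; the imaginary part
`S` integrates to `phase`. -/
lemma multiplier (h : IsEigenfunction w w' a b d g g') (hp : IsProfile w w' β m) (hb : b ≠ 0)
    (hper : ∀ y, w (y + τ) = w y) (heven : ∀ y, w (-y) = w y) (y : ℝ) :
    g (y + τ) = Complex.exp (Complex.I * phase w w' a b d τ) * g y := by
  have hD : ∀ y, w' y ^ 2 + 4 * b ^ 2 ≠ 0 := fun y => by positivity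
  have c1 := hp.continuous_fst
  have c2 := hp.continuous_snd
  set N : ℝ → ℝ := fun y => 2 * d ^ 2 * w y + 2 * a * d - 4 * w y ^ 2 with hN
  set R : ℝ → ℝ := fun y => N y * w' y / (w' y ^ 2 + 4 * b ^ 2) with hR
  set S : ℝ → ℝ := fun y => 2 * b * N y / (w' y ^ 2 + 4 * b ^ 2) with hS
  have cR : Continuous R := Continuous.div (by fun_prop) (by fun_prop) hD
  have cS : Continuous S := Continuous.div (by fun_prop) (by fun_prop) hD
  have hg : ∀ y, HasDerivAt g (((R y : ℂ) + S y * Complex.I) * g y) y := by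
    intro y
    refine (h.deriv_fst y).congr_deriv ?_
    have hDc : (w' y ^ 2 + 4 * b ^ 2 : ℂ) ≠ 0 := by exact_mod_cast hD y
    have hrel := h.rel_fst y
    simp only [hR, hS, hN]
    push_cast
    field_simp
    linear_combination (-2 * (w' y + 2 * Complex.I * b)) * hrel + (4 * b ^ 2 * g' y) * Complex.I_sq
  have hperw' := hp.deriv_periodic hper
  have hoddw' := hp.deriv_odd heven
  have hperq : Function.Periodic (fun y => (R y : ℂ) + S y * Complex.I) τ := by
    intro y
    simp only [hR, hS, hN, hper, hperw']
  have key := eq_exp_integral_of_deriv_eq_mul (by fun_prop) hg y (y + τ)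
  rw [hperq.intervalIntegral_add_eq y 0, zero_add] at key
  have hR0 : ∫ y in (0 : ℝ)..τ, R y = 0 := by
    apply integral_eq_zero_of_antisymm
    intro y
    have e1 : w (τ - y) = w y := by rw [← heven y, ← hper (-y)]; congr 1; ring
    have e2 : w' (τ - y) = -w' y := by rw [← hoddw' y, ← hperw' (-y)]; congr 1; ring
    simp only [hR, hN, e1, e2]
    ring
  rw [key, intervalIntegral.integral_add (Continuous.intervalIntegrable (by fun_prop) _ _)
    (Continuous.intervalIntegrable (by fun_prop) _ _), intervalIntegral.integral_mul_const,
    intervalIntegral.integral_ofReal, intervalIntegral.integral_ofReal, hR0]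
  have : phase w w' a b d τ = ∫ y in (0 : ℝ)..τ, S y := rfl
  rw [this]
  congr 2
  push_cast
  ring

/-- When `b = 0`, eigenfunctions are even or odd at every symmetry point of the metric. -/
lemma reflection (h : IsEigenfunction w w' a 0 d g g') (hp : IsProfile w w' β m) {y₀ : ℝ}
    (hsym : ∀ y, w (y₀ - y) = w (y₀ + y)) (hsym' : ∀ y, w' (y₀ - y) = -w' (y₀ + y))
    (hne : a ^ 2 ≠ w y₀ ^ 3) :
    ∃ ε : ℂ, (ε = 1 ∨ ε = -1) ∧ ∀ y, g (y₀ + y) = ε * g (y₀ - y) := by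
  have c1 := hp.continuous_fst
  have c2 := hp.continuous_snd
  have hwc : ∀ y, (w y : ℂ) ≠ 0 := fun y => by exact_mod_cast (hp.pos y).ne'
  have hcrit : w' y₀ = 0 := by
    have := hsym' 0
    simp only [sub_zero, add_zero] at this
    linarith
  -- For `b = 0` the second-order equation is invariant under reflection at `y₀`, so a parity that
  -- holds for the data at `y₀` propagates.
  have main : ∀ ε : ℂ, g y₀ = ε * g y₀ → g' y₀ + ε * g' y₀ = 0 →
      ∀ y, g (y₀ + y) = ε * g (y₀ - y) := by
    intro ε h1 h2 y
    have := linear_system_eq_zero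
      (M := fun y => (!![0, 1;
        -2 * w (y₀ + y) - a * d / w (y₀ + y), w' (y₀ + y) / 2 / w (y₀ + y)] :
          Matrix (Fin 2) (Fin 2) ℂ))
      (v := fun y => ![g (y₀ + y) - ε * g (y₀ - y), g' (y₀ + y) + ε * g' (y₀ - y)])
      (fun i j => by
        have hc : Continuous fun y => (w (y₀ + y) : ℂ) := by fun_prop
        fin_cases i <;> fin_cases j <;> simp
        · exact continuous_const
        · exact continuous_const
        · exact Continuous.sub (by fun_prop) (Continuous.div (by fun_prop) hc fun y => hwc _)
        · exact Continuous.div (by fun_prop) hc fun y => hwc _)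
      (fun i t => by
        have d1 : HasDerivAt (fun t : ℝ => y₀ + t) 1 t := (hasDerivAt_id t).const_add y₀
        have d2 : HasDerivAt (fun t : ℝ => y₀ - t) (-1) t := (hasDerivAt_id t).const_sub y₀
        have hwt := hwc (y₀ + t)
        fin_cases i
        · refine (((h.deriv_fst (y₀ + t)).scomp t d1).sub
            (((h.deriv_fst (y₀ - t)).scomp t d2).const_mul ε)).congr_deriv ?_
          simp
        · refine (((h.deriv_snd (y₀ + t)).scomp t d1).add
            (((h.deriv_snd (y₀ - t)).scomp t d2).const_mul ε)).congr_deriv ?_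
          simp [hsym, hsym']
          field_simp
          rw [Complex.I_sq]
          ring)
      (by
        funext i
        fin_cases i
        · simpa [sub_eq_zero] using h1
        · simpa using h2) y
    have h3 := congrFun this 0
    simp at h3
    exact sub_eq_zero.1 h3
  by_cases hg' : g' y₀ = 0
  · exact ⟨1, Or.inl rfl, main 1 (by simp) (by simp [hg'])⟩
  -- If `g'(y₀) ≠ 0`, then `rel_snd` gives `d w(y₀) = a`, and `rel_fst` becomes a multiple of `(a² -
  -- w(y₀)³) g(y₀) = 0`. Hence `g(y₀) = 0`, and `g` is odd about `y₀`.
  · refine ⟨-1, Or.inr rfl, main (-1) ?_ (by simp)⟩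
    have r1 := h.rel_fst y₀
    have r2 := h.rel_snd y₀
    simp only [hcrit, Complex.ofReal_zero, mul_zero, zero_div, zero_mul, sub_zero, add_zero,
      zero_add] at r1 r2
    have e1 : (d * w y₀ : ℂ) = a := by
      have : Complex.I * g' y₀ * (d * w y₀ - a) = 0 := by linear_combination r2
      exact sub_eq_zero.1 ((mul_eq_zero.1 this).resolve_left (mul_ne_zero Complex.I_ne_zero hg'))
    have hg0 : g y₀ = 0 := by
      refine (mul_eq_zero.1 r1).resolve_left fun h0 => hne ?_
      have : (a ^ 2 : ℂ) = w y₀ ^ 3 := by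
        rw [← e1] at h0 ⊢
        linear_combination (1 / 2 : ℂ) * w y₀ * h0
      exact_mod_cast this
    simp [hg0]

/-- Translation by `τ` is the composition of the reflections at `0` and at `τ/2`, each of which acts
on `g` by a sign. Nonconstancy of `w` supplies the condition `a² ≠ w³` at both points, through
`eq_const`. -/
lemma multiplier_real (h : IsEigenfunction w w' a 0 d g g') (hp : IsProfile w w' β (a ^ 2))
    (hper : ∀ y, w (y + τ) = w y) (heven : ∀ y, w (-y) = w y) (hne : ∃ y, w y ≠ w 0) :
    ∃ k : ℤ, ∀ y, g (y + τ) = Complex.exp (Complex.I * (k * Real.pi : ℝ)) * g y := by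
  have hperw' := hp.deriv_periodic hper
  have hoddw' := hp.deriv_odd heven
  have hnc : ∀ y₀, w' y₀ = 0 → a ^ 2 ≠ w y₀ ^ 3 := by
    intro y₀ h0 h1
    obtain ⟨y, hy⟩ := hne
    exact hy ((hp.eq_const h0 h1.symm y).trans (hp.eq_const h0 h1.symm 0).symm)
  obtain ⟨ε₁, hε₁, h1⟩ := h.reflection hp (y₀ := 0) (fun y => by simp [heven])
    (fun y => by simp [hoddw']) (hnc 0 hp.crit)
  have hs : ∀ y, w (τ / 2 - y) = w (τ / 2 + y) := fun y => by
    rw [← heven, ← hper]; congr 1; ring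
  have hs' : ∀ y, w' (τ / 2 - y) = -w' (τ / 2 + y) := fun y => by
    rw [← hoddw', ← hperw' (-(τ / 2 + y))]; congr 1; ring
  have hT0 : w' (τ / 2) = 0 := by
    have := hs' 0
    simp only [sub_zero, add_zero] at this
    linarith
  obtain ⟨ε₂, hε₂, h2⟩ := h.reflection hp hs hs' (hnc _ hT0)
  have hg : ∀ y, g (y + τ) = ε₂ * ε₁ * g y := by
    intro y
    have e1 := h2 (y + τ / 2)
    have e2 := h1 (-y)
    rw [show τ / 2 + (y + τ / 2) = y + τ by ring, show τ / 2 - (y + τ / 2) = -y by ring] at e1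
    simp only [zero_add, zero_sub, neg_neg] at e2
    rw [e1, e2]; ring
  have hpi : Complex.exp (Complex.I * Real.pi) = -1 := by
    rw [mul_comm, Complex.exp_pi_mul_I]
  rcases hε₁ with rfl | rfl <;> rcases hε₂ with rfl | rfl
  · exact ⟨0, fun y => by rw [hg]; simp⟩
  · exact ⟨1, fun y => by rw [hg]; simp [hpi]⟩
  · exact ⟨1, fun y => by rw [hg]; simp [hpi]⟩
  · exact ⟨0, fun y => by rw [hg]; simp⟩

end IsEigenfunction

end

/-! ### Arithmetic of the period lattice -/

lemma exp_I_mul_eq_iff {s t : ℝ} :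
    Complex.exp (Complex.I * s) = Complex.exp (Complex.I * t) ↔
      ∃ n : ℤ, s - t = n * (2 * Real.pi) := by
  rw [Complex.exp_eq_exp_iff_exists_int]
  refine exists_congr fun n => ?_
  constructor
  · intro h
    have h1 : Complex.I * ((s : ℂ) - t) = Complex.I * (n * (2 * Real.pi)) := by
      linear_combination h
    have := mul_left_cancel₀ Complex.I_ne_zero h1
    exact_mod_cast this
  · intro h
    have h1 : (s : ℂ) - t = n * (2 * Real.pi) := by exact_mod_cast congrArg Complex.ofReal h
    linear_combination Complex.I * h1

/-- `s + i n τ` is a period: all phases agree modulo `2π`. -/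
def IsPeriodPair (d θ : Fin 3 → ℝ) (s : ℝ) (n : ℤ) : Prop :=
  ∀ i j, ∃ k : ℤ, (d i * s + n * θ i) - (d j * s + n * θ j) = k * (2 * Real.pi)

lemma isPeriodPair_of_two {d θ : Fin 3 → ℝ} {s : ℝ} {n k l : ℤ}
    (h1 : (d 0 * s + n * θ 0) - (d 1 * s + n * θ 1) = k * (2 * Real.pi))
    (h2 : (d 0 * s + n * θ 0) - (d 2 * s + n * θ 2) = l * (2 * Real.pi)) :
    IsPeriodPair d θ s n := by
  intro i j
  fin_cases i <;> fin_cases j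
  · exact ⟨0, by simp⟩
  · exact ⟨k, h1⟩
  · exact ⟨l, h2⟩
  · exact ⟨-k, by push_cast; linear_combination -h1⟩
  · exact ⟨0, by simp⟩
  · exact ⟨l - k, by push_cast; linear_combination h2 - h1⟩
  · exact ⟨-l, by push_cast; linear_combination -h2⟩
  · exact ⟨k - l, by push_cast; linear_combination h1 - h2⟩
  · exact ⟨0, by simp⟩

lemma IsPeriodPair.comb {d θ : Fin 3 → ℝ} {s t : ℝ} {n m : ℤ} (h₁ : IsPeriodPair d θ s n)
    (h₂ : IsPeriodPair d θ t m) (p q : ℤ) : IsPeriodPair d θ (p * s + q * t) (p * n + q * m) := by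
  intro i j
  obtain ⟨k, hk⟩ := h₁ i j
  obtain ⟨l, hl⟩ := h₂ i j
  refine ⟨p * k + q * l, ?_⟩
  push_cast
  linear_combination (p : ℝ) * hk + (q : ℝ) * hl

lemma linearIndependent_pair_iff {ω₁ ω₂ : ℂ} :
    LinearIndependent ℝ ![ω₁, ω₂] ↔ ω₁.re * ω₂.im - ω₁.im * ω₂.re ≠ 0 := by
  rw [LinearIndependent.pair_iff]
  constructor
  · intro h h0
    by_cases hz : ω₁ = 0
    · have := (h 1 0 (by simp [hz])).1
      exact one_ne_zero this
    · have h1 := h ω₂.re (-ω₁.re) (by apply Complex.ext <;> simp <;> linarith)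
      have h2 := h ω₂.im (-ω₁.im) (by apply Complex.ext <;> simp <;> linarith)
      apply hz
      apply Complex.ext
      · simpa using h1.2
      · simpa using h2.2
  · intro h s t hst
    have hre := congrArg Complex.re hst
    have him := congrArg Complex.im hst
    simp at hre him
    constructor
    · have : s * (ω₁.re * ω₂.im - ω₁.im * ω₂.re) = 0 := by
        linear_combination ω₂.im * hre - ω₂.re * him
      exact (mul_eq_zero.1 this).resolve_right h
    · have : t * (ω₁.re * ω₂.im - ω₁.im * ω₂.re) = 0 := by
        linear_combination ω₁.re * him - ω₁.im * hre
      exact (mul_eq_zero.1 this).resolve_right h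

lemma lattice_iff {d θ : Fin 3 → ℝ} {τ : ℝ} (hτ : 0 < τ) :
    (∃ ω₁ ω₂ : ℂ, LinearIndependent ℝ ![ω₁, ω₂] ∧
      (∃ (s : ℝ) (n : ℤ), ω₁ = s + (n * τ : ℝ) * Complex.I ∧ IsPeriodPair d θ s n) ∧
      ∃ (s : ℝ) (n : ℤ), ω₂ = s + (n * τ : ℝ) * Complex.I ∧ IsPeriodPair d θ s n) ↔
    (∃ s : ℝ, s ≠ 0 ∧ IsPeriodPair d θ s 0) ∧
      ∃ (s : ℝ) (n : ℤ), n ≠ 0 ∧ IsPeriodPair d θ s n := by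
  constructor
  · rintro ⟨ω₁, ω₂, hli, ⟨s, n, rfl, h₁⟩, ⟨t, m, rfl, h₂⟩⟩
    rw [linearIndependent_pair_iff] at hli
    simp at hli
    have hdet : s * m - n * t ≠ 0 := by
      intro h0
      apply hli
      linear_combination τ * h0
    constructor
    -- The combination `m ω₁ - n ω₂` is real, and by linear independence it is nonzero.
    · refine ⟨m * s + (-n : ℤ) * t, ?_, ?_⟩
      · push_cast; intro h0; apply hdet; linarith
      · have := h₁.comb h₂ m (-n)
        rwa [show m * n + -n * m = 0 by ring] at this
    · by_cases hn : n = 0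
      · refine ⟨t, m, ?_, h₂⟩
        rintro rfl
        apply hdet
        simp [hn]
      · exact ⟨s, n, hn, h₁⟩
  · rintro ⟨⟨s, hs, h₁⟩, t, n, hn, h₂⟩
    refine ⟨s + ((0 : ℤ) * τ : ℝ) * Complex.I, t + (n * τ : ℝ) * Complex.I, ?_,
      ⟨s, 0, rfl, h₁⟩, ⟨t, n, rfl, h₂⟩⟩
    rw [linearIndependent_pair_iff]
    simp
    exact ⟨hs, hn, hτ.ne'⟩

/-- For `n = 0` the phases `θ` drop out. With `d_2 = -d_0 - d_1` the two congruences put `3 d_0 s`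
and `3 d_1 s` in `2πℤ`; conversely, a common denominator gives `s`. -/
lemma exists_real_period_iff {d θ : Fin 3 → ℝ} (hd : Function.Injective d)
    (hsum : d 0 + d 1 + d 2 = 0) :
    (∃ s : ℝ, s ≠ 0 ∧ IsPeriodPair d θ s 0) ↔ (d 1 = 0 ∨ ∃ q : ℚ, d 0 / d 1 = q) := by
  have hpi := Real.pi_pos.ne'
  have h2 : d 2 = -d 0 - d 1 := by linarith
  constructor
  · rintro ⟨s, hs, hp⟩
    by_cases h1 : d 1 = 0
    · exact Or.inl h1
    right
    obtain ⟨k, hk⟩ := hp 0 1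
    obtain ⟨l, hl⟩ := hp 0 2
    rw [h2] at hl
    simp at hk hl
    refine ⟨(k + l : ℚ) / (l - 2 * k), ?_⟩
    push_cast
    have e1 : 3 * d 0 * s = (k + l) * (2 * Real.pi) := by linarith
    have e2 : 3 * d 1 * s = (l - 2 * k) * (2 * Real.pi) := by linarith
    have hne : ((l : ℝ) - 2 * k) ≠ 0 := by
      intro h0
      rw [h0, zero_mul] at e2
      simp [h1, hs] at e2
    rw [div_eq_div_iff h1 hne]
    apply mul_left_cancel₀ (mul_ne_zero (mul_ne_zero (three_ne_zero (α := ℝ)) hs)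
      (mul_ne_zero two_ne_zero hpi))
    linear_combination (l - 2 * k : ℝ) * (2 * Real.pi) * e1 - (k + l : ℝ) * (2 * Real.pi) * e2
  · intro h
    by_cases h1 : d 1 = 0
    · have h0 : d 0 ≠ 0 := fun h0 => by
        have := hd (h0.trans h1.symm)
        exact absurd this (by decide)
      refine ⟨2 * Real.pi / d 0, by positivity, isPeriodPair_of_two (k := 1) (l := 2) ?_ ?_⟩
      · rw [h1]; field_simp; simp; ring
      · rw [h2, h1]; field_simp; push_cast; ring
    · obtain ⟨q, hq⟩ := h.resolve_left h1
      have hq' : d 0 * q.den = q.num * d 1 := by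
        rw [div_eq_iff h1] at hq
        have hqd : (q : ℝ) * q.den = q.num := by exact_mod_cast Rat.mul_den_eq_num q
        rw [hq]; linear_combination d 1 * hqd
      have hden : (q.den : ℝ) ≠ 0 := by exact_mod_cast q.den_ne_zero
      refine ⟨2 * Real.pi * q.den / d 1, by positivity,
        isPeriodPair_of_two (k := q.num - q.den) (l := 2 * q.num + q.den) ?_ ?_⟩
      · field_simp; push_cast; linear_combination 2 * Real.pi * hq'
      · rw [h2]; field_simp; push_cast; linear_combination 4 * Real.pi * hq'

/-- The congruences read `(d_0 - d_j)(s + n((d_0 + d_j) I + K)) ∈ 2πℤ` for `j = 1, 2`. As the ratio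
`ρ` of `d_0 - d_2` to `d_0 - d_1` is rational, `ρ` times the first minus the second eliminates `s`
and `K`, leaving `n I (d_0 - d_2)(d_1 - d_2)`. -/
lemma exists_skew_period_iff {d θ : Fin 3 → ℝ} {β I K : ℝ} (hd : Function.Injective d)
    (hsum : d 0 + d 1 + d 2 = 0) (hβ : d 0 * d 1 + d 0 * d 2 + d 1 * d 2 = -β)
    (hθ : ∀ i j, θ i - θ j = (d i ^ 2 - d j ^ 2) * I + (d i - d j) * K)
    (hq : d 1 = 0 ∨ ∃ q : ℚ, d 0 / d 1 = q) :
    (∃ (s : ℝ) (n : ℤ), n ≠ 0 ∧ IsPeriodPair d θ s n) ↔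
      ∃ q : ℚ, 1 / (2 * Real.pi) * I * (d 0 * d 1 + 2 * β / 3) = q := by
  have hpi := Real.pi_pos.ne'
  have h2 : d 2 = -d 0 - d 1 := by linarith
  have h01 : d 0 - d 1 ≠ 0 := fun h => by
    have := hd (sub_eq_zero.1 h)
    exact absurd this (by decide)
  have hprod : (d 0 - d 2) * (d 1 - d 2) = 3 * (d 0 * d 1 + 2 * β / 3) := by
    rw [h2] at hβ ⊢
    linear_combination (-2 : ℝ) * hβ
  constructor
  · rintro ⟨s, n, hn, hp⟩
    have hnr : (n : ℝ) ≠ 0 := by exact_mod_cast hn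
    obtain ⟨k, hk⟩ := hp 0 1
    obtain ⟨l, hl⟩ := hp 0 2
    obtain ⟨ρ, hρ⟩ : ∃ ρ : ℚ, d 0 - d 2 = ρ * (d 0 - d 1) := by
      rcases hq with h1 | ⟨q, hq⟩
      · exact ⟨2, by rw [h2, h1]; push_cast; ring⟩
      · by_cases h1 : d 1 = 0
        · exact ⟨2, by rw [h2, h1]; push_cast; ring⟩
        · rw [div_eq_iff h1] at hq
          have hq1 : (q : ℝ) - 1 ≠ 0 := by
            intro h0
            apply h01
            rw [hq]; linear_combination d 1 * h0
          refine ⟨(2 * q + 1) / (q - 1), ?_⟩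
          rw [h2, hq]; push_cast; field_simp; ring
    refine ⟨(ρ * k - l) / (3 * n), ?_⟩
    have e1 : (d 0 - d 1) * (s + n * ((d 0 + d 1) * I + K)) = k * (2 * Real.pi) := by
      linear_combination hk - (n : ℝ) * hθ 0 1
    have e2 : (d 0 - d 2) * (s + n * ((d 0 + d 2) * I + K)) = l * (2 * Real.pi) := by
      linear_combination hl - (n : ℝ) * hθ 0 2
    push_cast
    rw [eq_div_iff (by positivity), one_div]
    have e3 : n * I * ((d 0 - d 2) * (d 1 - d 2)) = (ρ * k - l) * (2 * Real.pi) := by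
      linear_combination (ρ : ℝ) * e1 - e2
        + (s + n * ((d 0 + d 1) * I + K)) * hρ
    rw [hprod] at e3
    field_simp
    linear_combination e3
  · rintro ⟨q, hq⟩
    have hden : (q.den : ℝ) ≠ 0 := by exact_mod_cast q.den_ne_zero
    have hqd : (q : ℝ) * q.den = q.num := by exact_mod_cast Rat.mul_den_eq_num q
    have e3 : I * ((d 0 - d 2) * (d 1 - d 2)) = 3 * q * (2 * Real.pi) := by
      rw [hprod, ← hq]; field_simp
    -- With `n` the denominator of `q`, this `s` makes the first phase difference exactly zero; the
    -- second is then `-3 q.num` times `2π`.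
    refine ⟨-(q.den : ℝ) * ((d 0 + d 1) * I + K), q.den, by exact_mod_cast q.den_ne_zero,
      isPeriodPair_of_two (k := 0) (l := -3 * q.num) ?_ ?_⟩
    · push_cast; linear_combination (q.den : ℝ) * hθ 0 1
    · push_cast; linear_combination (q.den : ℝ) * hθ 0 2 - (q.den : ℝ) * e3 - 6 * Real.pi * hqd

/-- When all phases are multiples of `π`, twice the period of the metric is a period. -/
lemma isPeriodPair_two {d θ : Fin 3 → ℝ} (h : ∀ j, ∃ k : ℤ, θ j = k * Real.pi) :
    IsPeriodPair d θ 0 2 := by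
  intro i j
  obtain ⟨k, hk⟩ := h i
  obtain ⟨l, hl⟩ := h j
  refine ⟨k - l, ?_⟩
  rw [hk, hl]; push_cast; ring

/-! ### The flat case -/

lemma periodic_of_deriv_eq_const_mul {φ : ℝ → ℂ} {c : ℂ} {p : ℝ}
    (hφ : ∀ t, HasDerivAt φ (c * φ t) t) (hp : Complex.exp (p * c) = 1) (t : ℝ) :
    φ (t + p) = φ t := by
  have := eq_exp_integral_of_deriv_eq_mul (q := fun _ => c) continuous_const hφ t (t + p)
  rw [this]
  simp [hp]

/-- Solutions of the system with constant coefficients of Clifford type are doubly periodic. -/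
lemma IsFrame.flat_periods {w w' : ℝ → ℝ} {κ : ℝ} {X P Q : ℝ → ℝ → ℂ}
    (h : IsFrame w w' (κ ^ 3) 0 X P Q) (hκ : κ ≠ 0) (hw : ∀ y, w y = κ ^ 2) (hw' : ∀ y, w' y = 0)
    (x y : ℝ) :
    X (x + 2 * Real.pi / κ) y = X x y ∧ X x (y + 2 * Real.pi / (√3 * κ)) = X x y := by
  have hκc : (κ : ℂ) ≠ 0 := by exact_mod_cast hκ
  have hI := Complex.I_ne_zero
  have h3 : (√3 : ℝ) ≠ 0 := by positivity
  have h3c : ((√3 : ℝ) : ℂ) ≠ 0 := by exact_mod_cast h3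
  have h3s : ((√3 : ℝ) : ℂ) ^ 2 = 3 := by
    have : (√3 : ℝ) ^ 2 = 3 := Real.sq_sqrt (by norm_num)
    exact_mod_cast this
  have hII := Complex.I_sq
  have e1 : Complex.I * ((κ ^ 3 : ℝ) : ℂ) / ((κ ^ 2 : ℝ) : ℂ) = Complex.I * κ := by
    push_cast; field_simp
  have hpx := fun x y => h.px x y
  have hpy := fun x y => h.py x y
  have hqx := fun x y => h.qx x y
  have hqy := fun x y => h.qy x y
  simp only [hw, hw', e1, Complex.ofReal_zero, neg_zero, zero_div, mul_zero, add_zero, sub_zero,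
    zero_mul, zero_add] at hpx hpy hqx hqy
  push_cast at hpx hqy
  have exp1 : ∀ c : ℂ, c ≠ 0 → Complex.exp ((2 * Real.pi / c) * (c * Complex.I)) = 1 := by
    intro c hc
    rw [← Complex.exp_two_pi_mul_I]; congr 1; field_simp
  constructor
  -- The cubic is now `(t - κ)²(t + 2κ)`. The combinations `P + 2iκX` and `P - iκX` satisfy scalar
  -- equations in `x` with exponents `iκ` and `-2iκ`, and their difference is `3iκX`.
  · have k1 := periodic_of_deriv_eq_const_mul (φ := fun x => P x y + 2 * Complex.I * κ * X x y)
      (c := κ * Complex.I) (p := 2 * Real.pi / κ)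
      (fun t => ((hpx t y).add ((h.x t y).const_mul _)).congr_deriv (by
        linear_combination (-2 * κ ^ 2 * X t y) * hII))
      (by push_cast; exact exp1 κ hκc) x
    have m1 := periodic_of_deriv_eq_const_mul (φ := fun x => P x y - Complex.I * κ * X x y)
      (c := -2 * (κ * Complex.I)) (p := 2 * Real.pi / κ)
      (fun t => ((hpx t y).sub ((h.x t y).const_mul _)).congr_deriv (by
        linear_combination (-2 * κ ^ 2 * X t y) * hII))
      (by
        push_cast
        have e := exp1 κ hκc
        have : (2 * Real.pi / κ * (-2 * (κ * Complex.I)) : ℂ)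
            = ((-2 : ℤ) : ℂ) * (2 * Real.pi / κ * (κ * Complex.I)) := by push_cast; ring
        rw [this, Complex.exp_int_mul, e, one_zpow]) x
    apply mul_left_cancel₀ (mul_ne_zero (mul_ne_zero (three_ne_zero (α := ℂ)) hI) hκc)
    linear_combination k1 - m1
  -- In the `y` direction the exponents are `±i√3κ` and `0`; the last belongs to `P - iκX`.
  · have hσ : ((√3 : ℝ) : ℂ) * κ ≠ 0 := mul_ne_zero h3c hκc
    have k1 := periodic_of_deriv_eq_const_mul
      (φ := fun y => 3 * Complex.I * κ * Q x y
        + (√3 : ℝ) * κ * Complex.I * (P x y + 2 * Complex.I * κ * X x y))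
      (c := (√3 : ℝ) * κ * Complex.I) (p := 2 * Real.pi / (√3 * κ))
      (fun t => (((hqy x t).const_mul _).add
        (((hpy x t).add ((h.y x t).const_mul _)).const_mul _)).congr_deriv (by
        linear_combination (-(Complex.I ^ 2 * κ ^ 2) * (P x t + 2 * Complex.I * κ * X x t)) * h3s
          - (6 * Complex.I * κ ^ 3 * X x t) * hII))
      (by push_cast; exact exp1 _ hσ) y
    have n1 := periodic_of_deriv_eq_const_mul
      (φ := fun y => 3 * Complex.I * κ * Q x y
        - (√3 : ℝ) * κ * Complex.I * (P x y + 2 * Complex.I * κ * X x y))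
      (c := -((√3 : ℝ) * κ * Complex.I)) (p := 2 * Real.pi / (√3 * κ))
      (fun t => (((hqy x t).const_mul _).sub
        (((hpy x t).add ((h.y x t).const_mul _)).const_mul _)).congr_deriv (by
        linear_combination (-(Complex.I ^ 2 * κ ^ 2) * (P x t + 2 * Complex.I * κ * X x t)) * h3s
          - (6 * Complex.I * κ ^ 3 * X x t) * hII))
      (by
        push_cast
        have e := exp1 _ hσ
        rw [mul_neg, Complex.exp_neg, e, inv_one]) y
    have hm : ∀ t, HasDerivAt (fun y => P x y - Complex.I * κ * X x y) 0 t := fun t =>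
      ((hpy x t).sub ((h.y x t).const_mul _)).congr_deriv (by ring)
    have m1 := is_const_of_deriv_eq_zero (fun t => (hm t).differentiableAt)
      (fun t => (hm t).deriv) (y + 2 * Real.pi / (√3 * κ)) y
    apply mul_left_cancel₀ (mul_ne_zero (mul_ne_zero (mul_ne_zero (by norm_num : (6 : ℂ) ≠ 0) hI) hκc)
      (mul_ne_zero hσ hI))
    linear_combination k1 - n1 - (2 * ((√3 : ℝ) * κ * Complex.I)) * m1

lemma IsMinimalLagrangian.descendsToTorus_of_flat {f : ℂ → CP2} {G : ℂ → C3}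
    (h : IsMinimalLagrangian f G) {w w' : ℝ → ℝ} {κ : ℝ} (hκ : κ ≠ 0)
    (hw : ∀ y, w y = κ ^ 2) (hw' : ∀ y, w' y = 0)
    (hfr : ∀ L : C3 →L[ℂ] ℂ, IsFrame w w' (κ ^ 3) 0 (fun x y => L (G (x + y * Complex.I)))
      (fun x y => L (pd 1 G (x + y * Complex.I)))
      (fun x y => L (pd Complex.I G (x + y * Complex.I)))) :
    DescendsToTorus f := by
  have h3 : (√3 : ℝ) ≠ 0 := by positivity
  have hpi := Real.pi_pos.ne'
  refine ⟨(2 * Real.pi / κ : ℝ), (2 * Real.pi / (√3 * κ) : ℝ) * Complex.I, ?_, ?_, ?_⟩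
  · rw [linearIndependent_pair_iff]
    simp only [Complex.ofReal_re, Complex.ofReal_im, Complex.mul_re, Complex.mul_im,
      Complex.I_re, Complex.I_im, mul_zero, mul_one, sub_zero, add_zero]
    positivity
  · rw [h.lift.period_iff]
    refine ⟨1, norm_one, fun z => ?_⟩
    rw [one_smul]
    ext i
    have := ((hfr (EuclideanSpace.proj i)).flat_periods hκ hw hw' z.re z.im).1
    rw [Complex.re_add_im] at this
    have hz : z + (2 * Real.pi / κ : ℝ) = (z.re + 2 * Real.pi / κ : ℝ) + z.im * Complex.I := by
      conv_lhs => rw [← Complex.re_add_im z]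
      push_cast; ring
    rw [hz]
    exact this
  · rw [h.lift.period_iff]
    refine ⟨1, norm_one, fun z => ?_⟩
    rw [one_smul]
    ext i
    have := ((hfr (EuclideanSpace.proj i)).flat_periods hκ hw hw' z.re z.im).2
    rw [Complex.re_add_im] at this
    have hz : z + (2 * Real.pi / (√3 * κ) : ℝ) * Complex.I
        = z.re + (z.im + 2 * Real.pi / (√3 * κ) : ℝ) * Complex.I := by
      conv_lhs => rw [← Complex.re_add_im z]
      push_cast; ring
    rw [hz]
    exact this

/-! ### The spectral curve of the potential -/

/-- At `i t` the characteristic polynomial of `D(λ)` is `-i` times the cubic; the constant term is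
real because `|λ| = 1` makes `λ³ψ̄` the conjugate of `λ⁻³ψ`. This identifies the `d_j` with the
exponents of the translations in `x`. -/
lemma potential_charpoly_eq {psi lam : ℂ} {u0 : ℝ} (hlam : ‖lam‖ = 1) {d : Fin 3 → ℝ}
    (hd : (potential psi u0 lam).charpoly =
      ∏ j, (Polynomial.X - Polynomial.C (Complex.I * (d j : ℂ)))) (t : ℝ) :
    t ^ 3 - betaConst psi (Real.exp u0) * t + 2 * (lam⁻¹ ^ 3 * psi).re
      = (t - d 0) * (t - d 1) * (t - d 2) := by
  have hl : lam ≠ 0 := by intro h; rw [h, norm_zero] at hlam; exact zero_ne_one hlam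
  have hconj : conj lam = lam⁻¹ := by
    rw [Complex.inv_def, Complex.normSq_eq_norm_sq, hlam]; simp
  have hre : (2 * (lam⁻¹ ^ 3 * psi).re : ℂ) = lam⁻¹ ^ 3 * psi + lam ^ 3 * conj psi := by
    have := Complex.add_conj (lam⁻¹ ^ 3 * psi)
    rw [map_mul, map_pow, map_inv₀, hconj, inv_inv] at this
    rw [this]; push_cast; ring
  have hnorm : ((‖psi‖ ^ 2 : ℝ) : ℂ) = psi * conj psi := by
    rw [Complex.mul_conj, Complex.normSq_eq_norm_sq]
  have hev := congrArg (Polynomial.eval (Complex.I * t)) hd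
  rw [Matrix.eval_charpoly, Polynomial.eval_prod, Fin.prod_univ_three, Matrix.det_fin_three] at hev
  have he : ((Real.exp (u0 / 2) : ℝ) : ℂ) ^ 2 = (Real.exp u0 : ℝ) := by
    rw [← Complex.ofReal_pow, ← Real.exp_nat_mul]; congr 2; push_cast; ring
  have he' : ((Real.exp (-u0) : ℝ) : ℂ) = ((Real.exp u0 : ℝ) : ℂ)⁻¹ := by
    rw [Real.exp_neg]; push_cast; rfl
  have hne : ((Real.exp u0 : ℝ) : ℂ) ≠ 0 := by exact_mod_cast (Real.exp_pos u0).ne'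
  have goal : ((t ^ 3 - betaConst psi (Real.exp u0) * t + 2 * (lam⁻¹ ^ 3 * psi).re : ℝ) : ℂ)
      = (((t - d 0) * (t - d 1) * (t - d 2) : ℝ) : ℂ) := by
    rw [betaConst]
    push_cast [-Complex.ofReal_exp] at hnorm ⊢
    rw [hre, hnorm]
    simp [potential, -Complex.ofReal_exp] at hev
    rw [he'] at hev
    generalize ((Real.exp (u0 / 2) : ℝ) : ℂ) = e at *
    generalize ((Real.exp u0 : ℝ) : ℂ) = E at *
    subst he
    have hI3 : Complex.I ^ 3 = -Complex.I := Complex.I_pow_three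
    have hI := Complex.I_ne_zero
    have he0 : e ≠ 0 := by rintro rfl; simp at hne
    apply mul_left_cancel₀ (neg_ne_zero.2 hI)
    field_simp at hev ⊢
    linear_combination -hev
  exact_mod_cast goal

/-! ### The torus condition -/

lemma cubic_coefficients {β a : ℝ} {d : Fin 3 → ℝ}
    (h : ∀ t : ℝ, t ^ 3 - β * t + 2 * a = (t - d 0) * (t - d 1) * (t - d 2)) :
    d 0 + d 1 + d 2 = 0 ∧ d 0 * d 1 + d 0 * d 2 + d 1 * d 2 = -β ∧ d 0 * d 1 * d 2 = -(2 * a) := by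
  have h0 := h 0
  have h1 := h 1
  have h2 := h (-1)
  refine ⟨?_, ?_, ?_⟩ <;> linarith

/-- Since the roots sum to zero, a double root `x` leaves `-2x` as the third; the cases record which
of them are called `d 0` and `d 1`. -/
lemma exists_double_root {d : Fin 3 → ℝ} {β a : ℝ} (hd : ¬ Function.Injective d)
    (h0 : d 0 + d 1 + d 2 = 0) (h1 : d 0 * d 1 + d 0 * d 2 + d 1 * d 2 = -β)
    (h2 : d 0 * d 1 * d 2 = -(2 * a)) :
    ∃ x : ℝ, β = 3 * x ^ 2 ∧ a = x ^ 3 ∧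
      ((d 0 = x ∧ d 1 = x) ∨ (d 0 = x ∧ d 1 = -2 * x) ∨ (d 0 = -2 * x ∧ d 1 = x)) := by
  have hor : d 0 = d 1 ∨ d 0 = d 2 ∨ d 1 = d 2 := by
    by_contra hcon
    push Not at hcon
    apply hd
    intro i j hij
    fin_cases i <;> fin_cases j <;> first | rfl | (simp at hij; grind)
  rcases hor with h | h | h
  · have h3 : d 2 = -2 * d 1 := by linarith
    rw [h, h3] at h1 h2
    exact ⟨d 1, by linarith, by linarith, Or.inl ⟨h, rfl⟩⟩
  · have h3 : d 1 = -2 * d 0 := by linarith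
    rw [← h, h3] at h1 h2
    exact ⟨d 0, by linarith, by linarith, Or.inr (Or.inl ⟨rfl, h3⟩)⟩
  · have h3 : d 0 = -2 * d 1 := by linarith
    rw [← h, h3] at h1 h2
    exact ⟨d 1, by linarith, by linarith, Or.inr (Or.inr ⟨h3, rfl⟩)⟩

lemma quotient_rational_of_double_root {d : Fin 3 → ℝ} {x : ℝ}
    (h : (d 0 = x ∧ d 1 = x) ∨ (d 0 = x ∧ d 1 = -2 * x) ∨ (d 0 = -2 * x ∧ d 1 = x)) :
    d 1 = 0 ∨ ∃ q : ℚ, d 0 / d 1 = q := by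
  by_cases hx : x = 0
  · left; rcases h with h | h | h <;> simp [h.2, hx]
  · right
    rcases h with ⟨h0, h1⟩ | ⟨h0, h1⟩ | ⟨h0, h1⟩ <;> rw [h0, h1]
    · exact ⟨1, by field_simp; norm_num⟩
    · exact ⟨-1 / 2, by push_cast; field_simp⟩
    · exact ⟨-2, by push_cast; field_simp⟩

/-- The double root forces the flat solution. -/
lemma flat_of_double_root {w₀ a b x : ℝ} (hw : 0 < w₀)
    (hβ : 3 * x ^ 2 = 2 * w₀ + (a ^ 2 + b ^ 2) / w₀ ^ 2) (ha : a = x ^ 3) :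
    b = 0 ∧ w₀ = x ^ 2 := by
  -- Clearing denominators in the formula for `β` yields a vanishing sum of two nonnegative terms.
  have h1 : (w₀ - x ^ 2) ^ 2 * (2 * w₀ + x ^ 2) + b ^ 2 = 0 := by
    rw [ha] at hβ
    field_simp at hβ
    linear_combination -hβ
  have h2 : 0 ≤ (w₀ - x ^ 2) ^ 2 * (2 * w₀ + x ^ 2) := by positivity
  have h3 : b ^ 2 = 0 := by nlinarith [sq_nonneg b]
  have h4 : (w₀ - x ^ 2) ^ 2 * (2 * w₀ + x ^ 2) = 0 := by linarith
  refine ⟨pow_eq_zero_iff two_ne_zero |>.1 h3, ?_⟩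
  have h5 := (mul_eq_zero.1 h4).resolve_right (by positivity)
  have := pow_eq_zero_iff two_ne_zero |>.1 h5
  linarith

namespace IsMinimalLagrangian

variable {f : ℂ → CP2} {G : ℂ → C3}

lemma speedSq_period (h : IsMinimalLagrangian f G) {v : ℂ} (hp : ∀ z, f (z + v) = f z) (z : ℂ) :
    speedSq G (v + z) = speedSq G z := by
  obtain ⟨c, hc, hG⟩ := (h.lift.period_iff v).1 hp
  have h1 := pd_translation (A := G) (U := c • ContinuousLinearMap.id ℂ C3) (w := v)
    (diff_of_smooth h.smooth) (fun z => by rw [add_comm, hG]; rfl) 1 z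
  rw [speedSq, speedSq, h1]
  simp [norm_smul, hc]

/-- Torus criterion in terms of the phases of the eigenfunctions. -/
lemma descendsToTorus_iff (h : IsMinimalLagrangian f G) {w : ℝ → ℝ} {τ : ℝ}
    (hτ : 0 < τ) (hmin : ∀ p, w p = w 0 → ∃ n : ℤ, p = n * τ)
    (hw : ∀ x y : ℝ, speedSq G (x + y * Complex.I) = 2 * w y)
    {d θ : Fin 3 → ℝ} {g : Fin 3 → ℝ → ℂ}
    (hne : ∀ j, ∃ y, g j y ≠ 0)
    (hper : ∀ (s p : ℝ) (c : ℂ), (∀ z, G (z + (s + p * Complex.I)) = c • G z) ↔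
        ∀ j y, Complex.exp (Complex.I * d j * s) * g j (y + p) = c * g j y)
    (hθ : ∀ j y, g j (y + τ) = Complex.exp (Complex.I * θ j) * g j y) :
    DescendsToTorus f ↔ (∃ s : ℝ, s ≠ 0 ∧ IsPeriodPair d θ s 0) ∧
      ∃ (s : ℝ) (n : ℤ), n ≠ 0 ∧ IsPeriodPair d θ s n := by
  have key : ∀ v : ℂ, (∀ z, f (z + v) = f z) ↔
      ∃ (s : ℝ) (n : ℤ), v = s + (n * τ : ℝ) * Complex.I ∧ IsPeriodPair d θ s n := by
    have hexp : ∀ (s : ℝ) (n : ℤ) j y, Complex.exp (Complex.I * d j * s) * g j (y + n * τ)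
        = Complex.exp (Complex.I * (d j * s + n * θ j : ℝ)) * g j y := by
      intro s n j y
      rw [iterate_multiplier (hθ j), ← mul_assoc, ← Complex.exp_add]
      congr 2
      push_cast; ring
    intro v
    constructor
    · intro hp
      have h1 := h.speedSq_period hp 0
      rw [add_zero, ← Complex.re_add_im v, hw] at h1
      have h2 := hw 0 0
      simp only [Complex.ofReal_zero, zero_mul, add_zero] at h2
      -- A period preserves the metric, and `hmin` says that `w` returns to its value at `0` only at
      -- multiples of `τ`.
      obtain ⟨n, hn⟩ := hmin v.im (by linarith)
      refine ⟨v.re, n, by rw [← hn, Complex.re_add_im], ?_⟩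
      obtain ⟨c, -, hc⟩ := (h.lift.period_iff v).1 hp
      rw [← Complex.re_add_im v, hper] at hc
      have hcj : ∀ j, Complex.exp (Complex.I * (d j * v.re + n * θ j : ℝ)) = c := by
        intro j
        obtain ⟨y, hy⟩ := hne j
        have := hc j y
        rw [hn, hexp] at this
        exact mul_right_cancel₀ hy this
      intro i j
      exact exp_I_mul_eq_iff.1 ((hcj i).trans (hcj j).symm)
    · rintro ⟨s, n, rfl, hp⟩
      rw [h.lift.period_iff]
      refine ⟨Complex.exp (Complex.I * (d 0 * s + n * θ 0 : ℝ)), ?_, ?_⟩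
      · rw [mul_comm, Complex.norm_exp_ofReal_mul_I]
      · rw [hper]
        intro j y
        rw [hexp, exp_I_mul_eq_iff.2 (hp j 0)]
  rw [← lattice_iff hτ]
  unfold DescendsToTorus
  simp only [key]

/-- The metric of an equivariant surface is given by a profile. -/
lemma isProfile (h : IsMinimalLagrangian f G) (he : IsTranslationallyEquivariant f)
    (hcrit : pd Complex.I (speedSq G) 0 = 0) :
    IsProfile (fun y => speedSq G (y * Complex.I) / 2)
      (fun y => pd Complex.I (speedSq G) (y * Complex.I) / 2)
      (betaConst (hopf G 0) (speedSq G 0 / 2)) (‖hopf G 0‖ ^ 2) ∧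
    (∀ x y : ℝ, speedSq G (x + y * Complex.I) = 2 * (speedSq G (y * Complex.I) / 2)) ∧
    (∀ x y : ℝ, pd Complex.I (speedSq G) (x + y * Complex.I)
      = 2 * (pd Complex.I (speedSq G) (y * Complex.I) / 2)) ∧
    ∀ z, pd 1 (speedSq G) z = 0 := by
  have hinv : ∀ (t : ℝ) z, speedSq G (t + z) = speedSq G z :=
    fun t z => (h.equivariant_invariants he t z).1
  have hd := h.differentiable_speedSq
  have hs := contDiff_speedSq h.smooth
  have hx : ∀ z, pd 1 (speedSq G) z = 0 := by
    intro z
    have hγ : HasDerivAt (fun s : ℝ => (s : ℂ) + z) 1 (0 : ℝ) := by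
      simpa using (Complex.ofRealCLM.hasDerivAt (x := (0 : ℝ))).add_const z
    have h1 := hasDerivAt_line hd hγ
    rw [funext fun s : ℝ => hinv s z] at h1
    simpa using h1.unique (hasDerivAt_const (0 : ℝ) (speedSq G z))
  have hver : ∀ y : ℝ, HasDerivAt (fun s : ℝ => (s : ℂ) * Complex.I) Complex.I y := fun y => by
    simpa using hasDerivAt_vertical 0 y
  have hzero : ((0 : ℝ) : ℂ) * Complex.I = 0 := by simp
  refine ⟨?_, fun x y => by rw [hinv]; ring, fun x y => ?_, hx⟩
  · have := isProfile_of_gauss (w := fun y => speedSq G (y * Complex.I) / 2)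
      (w' := fun y => pd Complex.I (speedSq G) (y * Complex.I) / 2)
      (w'' := fun y => pd Complex.I (pd Complex.I (speedSq G)) (y * Complex.I) / 2)
      (m := ‖hopf G 0‖ ^ 2) (fun y => half_pos (h.speedSq_pos _))
      (fun y => (hasDerivAt_line hd (hver y)).div_const 2)
      (fun y => (hasDerivAt_line (diff_of_smooth (contDiff_pd hs _)) (hver y)).div_const 2)
      (by simp [hcrit]) (fun y => by
        have := h.gauss (h.hopf_const he) hx (y * Complex.I)
        linear_combination (1 / 4 : ℝ) * this)
    simpa only [betaConst, hzero] using this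
  · rw [← pd_comp_add, funext (hinv x)]; ring

end IsMinimalLagrangian

/-- For `|λ| = 1` the denominator of `β₂` is `-(w' + 2ib)` with `b = Im (λ⁻³ψ)`. The resulting
integral is the coefficient of `d₁² - d₂²` in `phase_sub`. -/
lemma im_beta2 {psi lam : ℂ} (hlam : ‖lam‖ = 1) {u w w' : ℝ → ℝ} {β m : ℝ}
    (hprof : IsProfile w w' β m) (hu : ∀ y, Real.exp (u y) = w y)
    (hu' : ∀ y, Real.exp (u y) * deriv u y = w' y) (hb : (lam⁻¹ ^ 3 * psi).im ≠ 0) (τ : ℝ) :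
    (beta2 psi lam u τ).im = ∫ y in (0 : ℝ)..τ,
      4 * (lam⁻¹ ^ 3 * psi).im * w y / (w' y ^ 2 + 4 * (lam⁻¹ ^ 3 * psi).im ^ 2) := by
  have hconj : conj lam = lam⁻¹ := by
    rw [Complex.inv_def, Complex.normSq_eq_norm_sq, hlam]; simp
  set μ := lam⁻¹ ^ 3 * psi with hμ
  have hμc : lam ^ 3 * conj psi = conj μ := by
    rw [hμ, map_mul, map_pow, map_inv₀, hconj, inv_inv]
  have c1 := hprof.continuous_fst
  have c2 := hprof.continuous_snd
  have hden : ∀ y, conj μ - μ - (w' y : ℂ) ≠ 0 := by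
    intro y h0
    have := congrArg Complex.im h0
    simp at this
    apply hb; linarith
  have hcont : Continuous fun y => (2 * w y : ℂ) / (conj μ - μ - (w' y : ℂ)) :=
    Continuous.div (by fun_prop) (by fun_prop) hden
  have hbeta : beta2 psi lam u τ
      = ∫ y in (0 : ℝ)..τ, (2 * w y : ℂ) / (conj μ - μ - (w' y : ℂ)) := by
    unfold beta2
    simp only [hμc, ← hμ, hu']
    simp only [hu]
  rw [hbeta]
  have := Complex.imCLM.intervalIntegral_comp_comm (hcont.intervalIntegrable (0 : ℝ) τ)
    (μ := MeasureTheory.volume)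
  refine this.symm.trans ?_
  congr 1
  funext y
  have hD : w' y ^ 2 + 4 * μ.im ^ 2 ≠ 0 := by positivity
  have hn : Complex.normSq (conj μ - μ - (w' y : ℂ)) = w' y ^ 2 + 4 * μ.im ^ 2 := by
    rw [Complex.normSq_apply]; simp; ring
  rw [Complex.imCLM_apply, Complex.div_im, hn]
  simp
  ring

end EquivMinLag

theorem mainTheorem5
    (f : ℂ → CP2) (F : ℂ → C3) (hf : IsMinimalLagrangian f F)
    (hequiv : IsTranslationallyEquivariant f)
    -- the metric along the imaginary axis, with the origin at a critical point
    (u : ℝ → ℝ) (hu : ∀ y : ℝ, u y = logFactor F (y * Complex.I)) (hu0 : deriv u 0 = 0)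
    (ψ : ℂ) (hψ : ψ = hopf F 0) (hψ0 : ψ ≠ 0)
    -- the member at `lam` of the associated family
    (lam : ℂ) (hlam : ‖lam‖ = 1)
    (f' : ℂ → CP2) (F' : ℂ → C3) (hf' : IsMinimalLagrangian f' F')
    (hassoc : IsAssociate lam F F')
    -- the eigenvalues `i d 0, i d 1, i d 2` of the potential, in any order
    (d : Fin 3 → ℝ)
    (hd : (potential ψ (u 0) lam).charpoly =
      ∏ j, (Polynomial.X - Polynomial.C (Complex.I * (d j : ℂ))))
    -- the surface is not flat, or there is a multiple eigenvalue
    (hflat : (∃ y, u y ≠ u 0) ∨ ¬ Function.Injective d)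
    (β T : ℝ) (hβ : β = betaConst ψ (Real.exp (u 0)))
    (hT : T = halfPeriod ψ (Real.exp (u 0))) :
    DescendsToTorus f' ↔
      (d 1 = 0 ∨ ∃ q : ℚ, d 0 / d 1 = q) ∧
      (d 0 = d 1 ∨ (lam⁻¹ ^ 3 * ψ).im = 0 ∨
        ∃ q : ℚ, 1 / (2 * Real.pi) * (beta2 ψ lam u (2 * T)).im * (d 0 * d 1 + 2 * β / 3) = q) := by
  set w : ℝ → ℝ := fun y => speedSq F (y * Complex.I) / 2 with hw
  set w' : ℝ → ℝ := fun y => pd Complex.I (speedSq F) (y * Complex.I) / 2 with hw'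
  have huw : ∀ y, Real.exp (u y) = w y := fun y => by rw [hu, hf.exp_logFactor]
  have hwd : ∀ y, HasDerivAt w (w' y) y := fun y =>
    (hasDerivAt_line hf.differentiable_speedSq (by simpa using hasDerivAt_vertical 0 y)).div_const 2
  have huw' : ∀ y, Real.exp (u y) * deriv u y = w' y := by
    intro y
    have hul : u = fun y => Real.log (w y) := by
      funext y; rw [← huw, Real.log_exp]
    have hwy : w y ≠ 0 := by rw [← huw]; exact (Real.exp_pos _).ne'
    rw [huw, hul, ((hwd y).log hwy).deriv]
    field_simp
  have hcrit : pd Complex.I (speedSq F) 0 = 0 := by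
    have := huw' 0
    rw [hu0, mul_zero] at this
    simpa [hw'] using this.symm
  have hw0 : w 0 = speedSq F 0 / 2 := by simp [hw]
  obtain ⟨hprof, hE1, hE2, hE3⟩ := hf.isProfile hequiv hcrit
  rw [← hψ, ← hw0] at hprof
  rw [huw] at hβ hT
  rw [← hβ] at hprof
  change IsProfile w w' β (‖ψ‖ ^ 2) at hprof
  change ∀ x y : ℝ, speedSq F (x + y * Complex.I) = 2 * w y at hE1
  change ∀ x y : ℝ, pd Complex.I (speedSq F) (x + y * Complex.I) = 2 * w' y at hE2
  -- transfer to the associated surface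
  have hspeed : speedSq F' = speedSq F := by
    funext z
    have h1 := hf'.exp_logFactor z
    rw [(hassoc z).1, hf.exp_logFactor] at h1
    linarith
  have hH : ∀ z, hopf F' z
      = (lam⁻¹ ^ 3 * ψ).im - Complex.I * (lam⁻¹ ^ 3 * ψ).re := by
    intro z
    rw [(hassoc z).2, hf.hopf_const hequiv, ← hψ]
    conv_lhs => rw [mul_assoc, ← Complex.re_add_im (lam⁻¹ ^ 3 * ψ)]
    linear_combination (-(lam⁻¹ ^ 3 * ψ).im : ℂ) * Complex.I_sq
  rw [← hspeed] at hE1 hE2 hE3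
  have hcub := potential_charpoly_eq hlam hd
  rw [huw, ← hβ] at hcub
  have hnorm : (lam⁻¹ ^ 3 * ψ).re ^ 2 + (lam⁻¹ ^ 3 * ψ).im ^ 2 = ‖ψ‖ ^ 2 := by
    have : ‖lam⁻¹ ^ 3 * ψ‖ = ‖ψ‖ := by simp [hlam]
    rw [← this, ← Complex.normSq_eq_norm_sq, Complex.normSq_apply]; ring
  have him := fun hb => im_beta2 (psi := ψ) hlam hprof huw huw' hb (2 * T)
  set a := (lam⁻¹ ^ 3 * ψ).re with ha
  set b := (lam⁻¹ ^ 3 * ψ).im with hb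
  have hβ' : β = 2 * w 0 + (a ^ 2 + b ^ 2) / w 0 ^ 2 := by rw [hnorm, hβ, betaConst]
  obtain ⟨s0, s1, s2⟩ := cubic_coefficients hcub
  by_cases hinj : Function.Injective d
  · have hnc : ∃ y, w y ≠ w 0 := by
      obtain ⟨y, hy⟩ := hflat.resolve_right (not_not.2 hinj)
      refine ⟨y, fun h => hy ?_⟩
      rw [← huw, ← huw] at h
      exact Real.exp_injective h
    have hroot : ∀ j, d j ^ 3 - β * d j + 2 * a = 0 := by
      intro j
      rw [hcub]
      fin_cases j <;> simp
    obtain ⟨g, g', hg, hne, hper⟩ := hf'.exists_eigenfunctions hprof hβ' hH hE1 hE2 hE3 hinj hroot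
    obtain ⟨hT0, hTper, heven, hmin⟩ := IsProfile.periodicity hψ0 (hβ ▸ hprof)
    rw [← hT] at hT0 hTper hmin
    have hd01 : d 0 ≠ d 1 := fun h => absurd (hinj h) (by decide)
    rw [or_iff_right hd01]
    by_cases hb0 : b = 0
    · rw [hb0] at hg
      rw [← hnorm, hb0, zero_pow two_ne_zero, add_zero] at hprof
      choose k hk using fun j => (hg j).multiplier_real hprof hTper heven hnc
      rw [hf'.descendsToTorus_iff (by positivity) (hmin hnc) hE1 hne hper hk,
        exists_real_period_iff hinj s0]
      simp only [hb0, true_or, and_true]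
      -- All multipliers over `2T` are signs, so `4T i` is a period and only the rationality of
      -- `d_0/d_1` remains.
      exact and_iff_left ⟨0, 2, two_ne_zero, isPeriodPair_two fun j => ⟨k j, rfl⟩⟩
    · have hk := fun j => (hg j).multiplier hprof hb0 hTper heven
      rw [hf'.descendsToTorus_iff (by positivity) (hmin hnc) hE1 hne hper hk,
        exists_real_period_iff hinj s0, or_iff_right hb0, him hb0]
      refine and_congr_right fun hq => ?_
      refine exists_skew_period_iff (K := a * ∫ y in (0 : ℝ)..2 * T, 4 * b / (w' y ^ 2 + 4 * b ^ 2))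
        hinj s0 s1 (fun i j => ?_) hq
      rw [phase_sub hprof hb0]
      ring
  · obtain ⟨x, hx1, hx2, hx3⟩ := exists_double_root hinj s0 s1 s2
    obtain ⟨hb0, hwx⟩ := flat_of_double_root (hprof.pos 0) (hx1 ▸ hβ') hx2
    have hx : x ≠ 0 := by
      rintro rfl
      have := hprof.pos 0
      rw [hwx] at this
      simp at this
    have hconst : ∀ y, w y = x ^ 2 := fun y => by
      rw [← hwx]
      refine hprof.eq_const hprof.crit ?_ y
      rw [← hnorm, hb0, hx2, hwx]; ring
    have hw'0 : ∀ y, w' y = 0 := fun y => by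
      have := hwd y
      rw [funext hconst] at this
      exact this.unique (hasDerivAt_const _ _)
    -- With a multiple eigenvalue both conditions hold automatically: the quotient is `1`, `-1/2` or
    -- `-2`, and `λ⁻³ψ` is real.
    refine iff_of_true ?_ ⟨quotient_rational_of_double_root hx3, Or.inr (Or.inl hb0)⟩
    refine hf'.descendsToTorus_of_flat hx hconst hw'0 fun L => ?_
    rw [← hx2, ← hb0]
    exact hf'.isFrame hH hE1 hE2 hE3 L
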